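/- A Cantor basis of $\mathrm{GF}(2^{2^L})$ is a basis $(\beta_1,\dots,\beta_{2^L})$ over $\mathrm{GF}(2)$ with $\beta_1=1$ and $\beta_i^2-\beta_i=\beta_{i-1}$ for $i>1$. Put $\varpi_i=\sum_j i_j\beta_{j+1}$ for $i=\sum_j i_j2^j$ with $i_j\in\{0,1\}$, $0\le i<2^{2^L}$. Let $K=\mathrm{GF}(2^{2^L})$. For $m\le 1$ (that is, $m=1$) evaluation and interpolation at $a,a+1$ are done directly: $v_0=f_0+f_1a$, $v_1=v_0+f_1$, respectively $f=v_0+a(v_0+v_1)+(v_0+v_1)x$. For $m>1$ put $k=2^{\lceil\log_2 m\rceil-1}$ and $b=a^{2^k}-a$. * $\mathrm{EA}(f,a,m)$, $\deg f<2^m$, computes $f(a+\varpi_i)$ for $0\le i<2^m$: expand $f=\sum_{i<2^k}x^i\hat f_i(x^{2^k}-x)$ by the Gao–Mateer expansion (recursive splitting, $2^{m-1}(m-k)$ additions); compute $r_{ij}=\hat f_i(b+\varpi_j)$, $j<2^{m-k}$, by $\mathrm{EA}(\hat f_i,b,m-k)$; put $r_j=\sum_i r_{ij}x^i$; and obtain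 $f(a+\varpi_{i+j2^k})$, $i<2^k$, by $\mathrm{EA}(r_j,a+\varpi_{j2^k},k)$. * $\mathrm{IA}(v,a,m)$ computes the polynomial $f$ of degree $<2^m$ with $f(a+\varpi_i)=v_i$, $0\le i<2^m$, by the inverse steps in reverse order. * $\mathrm{MA}(F,G,m)$, for $F,G\in K[x]$ of degree $<2^m$, applies $\mathrm{EA}(\cdot,0,m+1)$ to $F$ and $G$, multiplies the values pointwise, and applies $\mathrm{IA}(\cdot,0,m+1)$. The special multiplication algorithm $\mathrm{SMA}(f,g,m)$ takes polynomials $f,g$ of degree $<2^m$ over $\mathrm{GF}(2)$. For $m=0$ it returns $f(0)g(0)$. For $m\ge1$ let $L=\lceil\log_2(m+1)\rceil$, fix a Cantor basis of $\mathrm{GF}(2^{2^L})$, and let $\beta=\beta_{2^L}$. Elements of $\mathrm{GF}(2^{2^L})$ are represented as polynomials of degree $<2^L$ over $\mathrm{GF}(2)$ in $\beta$. The algorithm cuts the coefficient sequences $(a_i)$, $(b_i)$ of $f,g$ into blocks of length $2^{L-1}$, forms $A_i=\sum_{j<2^{L-1}}a_{2^{L-1}i+j}\beta^j$ and $B_i=\sum_{j<2^{L-1}}b_{2^{L-1}i+j}\beta^j$,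 computes $\sum_i C_ix^i=\mathrm{MA}(\sum_i A_ix^i,\sum_i B_ix^i,m-L+1)$, writes $C_i=\sum_{j<2^L}h_{ij}\beta^j$ with $h_{ij}\in\{0,1\}$, and returns $\sum_i x^{2^{L-1}i}\sum_{j<2^L}h_{ij}x^j$. Two elements of $\mathrm{GF}(2^{2^L})$ are multiplied by multiplying the representing polynomials and reducing the product modulo the minimal polynomial of $\beta$ (by two further such multiplications, with precomputed polynomials, and additions); these multiplications of polynomials of degree $<2^L$ are done recursively by $\mathrm{SMA}(\cdot,\cdot,L)$ if $L<m$, and by the schoolbook method if $L\ge m$ (i.e. $m=1,2$). A bit operation is an addition or a multiplication in $\mathrm{GF}(2)$; the constants $\varpi_i$, the minimal polynomial of $\beta$, and the reduction constants are precomputed. **Theorem.** Cantor bases of $\mathrm{GF}(2^{2^L})$ exist for all $L\ge0$. For every choice of Cantor bases and all $m\ge0$, $\mathrm{SMA}(f,g,m)$ returns $fg$ for all polynomials $f,g$ of degree $<2^m$ over $\mathrm{GF}(2)$, and it costs $O(2^m m(\log m)^2)$ bit operations: there is an absolute constant $C$, independent of the Cantor bases, of $m$ and of $f,g$, such that for all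 $m\ge2$ the number of bit operations is at most $C\,2^m m(\log m)^2$. -/

import Mathlib

open Polynomial

/-- The result of a computation together with the number of elementary operations it used. -/
structure Costed (α : Type) where
  val : α
  cost : ℕ

namespace Costed

/-- Sequential composition: costs add up, and returning a value is free. -/
instance : Monad Costed where
  pure a := ⟨a, 0⟩
  bind x f := ⟨(f x.val).val, x.cost + (f x.val).cost⟩

/-- The loop `for i = 0 to n - 1: v i := g i; end for`. Arrays are functions on `ℕ`; the entries
outside the range of the loop get the default value `d`. The cost is the total cost of the body. -/
def tabulate {α : Type} (d : α) (n : ℕ) (g : ℕ → Costed α) : Costed (ℕ → α) :=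
  ⟨fun i => if i < n then (g i).val else d, ∑ i ∈ Finset.range n, (g i).cost⟩

end Costed

open Costed (tabulate)

/-- The operations that an algorithm may apply to data of type `X` representing elements of `K`.
All algorithms below are written for an arbitrary data type `X`, so that the data can only be
touched through `add` and `mul`; `const` makes a fixed element of `K` available as data. -/
structure Ops (K X : Type) where
  const : K → X
  add : X → X → Costed X
  mul : X → X → Costed X

/-- Bit operations: one addition or one multiplication in `GF(2)` costs one. -/
def bitOps : Ops (ZMod 2) (ZMod 2) where
  const c := c
  add x y := ⟨x + y, 1⟩
  mul x y := ⟨x * y, 1⟩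

section FieldAlgorithms

/-! ### Evaluation, interpolation and multiplication, counted in operations of `K`

A polynomial is given by its array of coefficients. All fields have characteristic two, so that
subtraction is addition. -/

variable {K X : Type} [Field K] (O : Ops K X)

/-- The zero datum. -/
def Ops.zero : X := O.const 0

/-- `a ^ (2 ^ k)` by `k` squarings. -/
def sqIter : ℕ → X → Costed X
  | 0, a => pure a
  | k + 1, a => do
    let b ← O.mul a a
    sqIter k b

/-- The expansion of a polynomial `f` of degree `< 2 ^ (k + r)` at `x ^ t - x`, `t = 2 ^ k`: entry
`j` of the output is the polynomial `h_j` of degree `< t` such that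
`f = ∑ j < 2 ^ r, h_j * (x ^ t - x) ^ j`. (So the `i`-th Gao-Mateer polynomial of `f` at `x ^ t - x`
is `∑ j, h_j,i * x ^ j`.)

With `s = 2 ^ (r - 1)` write `f = f₀ + x ^ (t * s) * (f₁ + x ^ ((t - 1) * s) * f₂)` and `h = f₁ + f₂`;
then `f = g₀ + (x ^ t - x) ^ s * g₁`, where `g₀ = f₀ + x ^ s * h` and
`g₁ = h + x ^ ((t - 1) * s) * f₂`. -/
def gaoMateer (k : ℕ) : ℕ → (ℕ → X) → Costed (ℕ → ℕ → X)
  | 0, f => pure fun j => if j = 0 then f else fun _ => O.zero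
  | r + 1, f => do
    let h ← tabulate O.zero ((2 ^ k - 1) * 2 ^ r) fun i =>
      if i < 2 ^ r then O.add (f (2 ^ k * 2 ^ r + i)) (f ((2 * 2 ^ k - 1) * 2 ^ r + i))
      else pure (f (2 ^ k * 2 ^ r + i))
    let g₀ ← tabulate O.zero (2 ^ k * 2 ^ r) fun i =>
      if i < 2 ^ r then pure (f i) else O.add (f i) (h (i - 2 ^ r))
    let g₁ : ℕ → X := fun i =>
      if i < (2 ^ k - 1) * 2 ^ r then h i else f (2 ^ k * 2 ^ r + i)
    let G₀ ← gaoMateer k r g₀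
    let G₁ ← gaoMateer k r g₁
    pure fun j => if j < 2 ^ r then G₀ j else G₁ (j - 2 ^ r)

/-- The inverse of `gaoMateer`: from `h_j`, `j < 2 ^ r`, the polynomial
`f = ∑ j < 2 ^ r, h_j * (x ^ (2 ^ k) - x) ^ j`, by undoing the steps of `gaoMateer`. -/
def gaoMateerInv (k : ℕ) : ℕ → (ℕ → ℕ → X) → Costed (ℕ → X)
  | 0, h => pure (h 0)
  | r + 1, h => do
    let g₀ ← gaoMateerInv k r h
    let g₁ ← gaoMateerInv k r fun j => h (j + 2 ^ r)
    let lo ← tabulate O.zero (2 ^ k * 2 ^ r) fun i =>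
      if i < 2 ^ r then pure (g₀ i) else O.add (g₀ i) (g₁ (i - 2 ^ r))
    let hi ← tabulate O.zero (2 ^ k * 2 ^ r) fun i =>
      if i < 2 ^ r then O.add (g₁ i) (g₁ (i + (2 ^ k - 1) * 2 ^ r)) else pure (g₁ i)
    pure fun i => if i < 2 ^ k * 2 ^ r then lo i else hi (i - 2 ^ k * 2 ^ r)

/-- `2 ^ (l - 1)` for `l = ⌈log₂ m⌉`. -/
def splitPoint (m : ℕ) : ℕ := 2 ^ (Nat.clog 2 m - 1)

theorem splitPoint_lt {m : ℕ} (hm : ¬ m ≤ 1) : splitPoint m < m :=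
  Nat.pow_pred_clog_lt_self one_lt_two (not_le.mp hm)

theorem sub_splitPoint_lt {m : ℕ} (hm : ¬ m ≤ 1) : m - splitPoint m < m :=
  Nat.sub_lt (by omega) (Nat.two_pow_pos _)

/-- The remaindering algorithm `RA(f, b, m, l, L)` with `k = 2 ^ (l - 1)`: entry `j < 2 ^ (m - k)` of
the output is the remainder of `f` modulo `x ^ (2 ^ k) - x - (b + ϖ_j)`. The argument `ea` is the
call of the evaluation algorithm `EA(·, ·, m - k, L)`. -/
def RA (ea : (ℕ → X) → X → Costed (ℕ → X)) (m k : ℕ) (f : ℕ → X) (b : X) :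
    Costed (ℕ → ℕ → X) := do
  let h ← gaoMateer O k (m - k) f
  let r ← tabulate (fun _ => O.zero) (2 ^ k) fun i => ea (fun j => h j i) b
  pure fun j i => r i j

/-- The evaluation algorithm `EA(f, a, m, L)`: for `f` of degree `< 2 ^ m` the output is the array of
the values `f (a + ϖ_i)`, `i < 2 ^ m`. -/
def EA (ϖ : ℕ → K) (m : ℕ) (f : ℕ → X) (a : X) : Costed (ℕ → X) :=
  if _hm : m ≤ 1 then do
    let p ← O.mul (f 1) a
    let v₀ ← O.add (f 0) p
    let v₁ ← O.add v₀ (f 1)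
    pure fun i => if i = 0 then v₀ else if i = 1 then v₁ else O.zero
  else do
    let c ← sqIter O (splitPoint m) a
    let b ← O.add c a
    let r ← RA O (fun g b => EA ϖ (m - splitPoint m) g b) m (splitPoint m) f b
    let v ← tabulate (fun _ => O.zero) (2 ^ (m - splitPoint m)) fun j =>
      O.add a (O.const (ϖ (j * 2 ^ splitPoint m))) >>= fun a_j => EA ϖ (splitPoint m) (r j) a_j
    pure fun u => v (u / 2 ^ splitPoint m) (u % 2 ^ splitPoint m)
  termination_by m
  decreasing_by
    · exact sub_splitPoint_lt _hm
    · exact splitPoint_lt _hm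

/-- The dividend reconstruction algorithm `DRA(r, b, m, l, L)` with `k = 2 ^ (l - 1)`: the polynomial
of degree `< 2 ^ m` whose remainder modulo `x ^ (2 ^ k) - x - (b + ϖ_j)` is `r_j`, `j < 2 ^ (m - k)`.
The argument `ia` is the call of the interpolation algorithm `IA(·, ·, m - k, L)`. -/
def DRA (ia : (ℕ → X) → X → Costed (ℕ → X)) (m k : ℕ) (r : ℕ → ℕ → X) (b : X) :
    Costed (ℕ → X) := do
  let t ← tabulate (fun _ => O.zero) (2 ^ k) fun i => ia (fun j => r j i) b
  gaoMateerInv O k (m - k) fun j i => t i j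

/-- The interpolation algorithm `IA(v, a, m, L)`: the polynomial `f` of degree `< 2 ^ m` such that
`f (a + ϖ_i) = v_i`, `i < 2 ^ m`. -/
def IA (ϖ : ℕ → K) (m : ℕ) (v : ℕ → X) (a : X) : Costed (ℕ → X) :=
  if _hm : m ≤ 1 then do
    let d ← O.add (v 0) (v 1)
    let p ← O.mul a d
    let c ← O.add (v 0) p
    pure fun i => if i = 0 then c else if i = 1 then d else O.zero
  else do
    let r ← tabulate (fun _ => O.zero) (2 ^ (m - splitPoint m)) fun j =>
      O.add a (O.const (ϖ (j * 2 ^ splitPoint m))) >>= fun a_j =>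
        IA ϖ (splitPoint m) (fun i => v (i + j * 2 ^ splitPoint m)) a_j
    let c ← sqIter O (splitPoint m) a
    let b ← O.add c a
    DRA O (fun w b => IA ϖ (m - splitPoint m) w b) m (splitPoint m) r b
  termination_by m
  decreasing_by
    · exact splitPoint_lt _hm
    · exact sub_splitPoint_lt _hm

/-- The multiplication algorithm `MA(f, g, m, L)` for polynomials of degree `< 2 ^ m` over `K`. -/
def MA (ϖ : ℕ → K) (m : ℕ) (f g : ℕ → X) : Costed (ℕ → X) := do
  let u ← EA O ϖ (m + 1) f O.zero
  let v ← EA O ϖ (m + 1) g O.zero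
  let w ← tabulate O.zero (2 ^ (m + 1)) fun i => O.mul (u i) (v i)
  IA O ϖ (m + 1) w O.zero

end FieldAlgorithms

/-! ### Cantor bases -/

/-- A Cantor basis of `GF(2 ^ (2 ^ L))` over `GF(2)`, indexed from `0`: `basis i` is `β_{i+1}`. -/
structure CantorBasis (L : ℕ) where
  basis : Module.Basis (Fin (2 ^ L)) (ZMod 2) (GaloisField 2 (2 ^ L))
  first : basis ⟨0, Nat.two_pow_pos L⟩ = 1
  step : ∀ (i : ℕ) (hi : i + 1 < 2 ^ L),
    basis ⟨i + 1, hi⟩ ^ 2 - basis ⟨i + 1, hi⟩ = basis ⟨i, Nat.lt_of_succ_lt hi⟩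

noncomputable section

namespace CantorBasis

variable {L : ℕ} (β : CantorBasis L)

/-- The last element `β_{2^L}` of the basis; its powers represent the field elements. -/
def gen : GaloisField 2 (2 ^ L) := β.basis ⟨2 ^ L - 1, Nat.sub_lt (Nat.two_pow_pos L) one_pos⟩

/-- The elements `ϖ_0, ϖ_1, …` of the field in the order given by the basis: `ϖ_i` is the sum of the
`β_{j+1}` over the binary digits `1` of `i`, where `j` is the position of the digit. -/
def elt (i : ℕ) : GaloisField 2 (2 ^ L) :=
  ∑ j : Fin (2 ^ L), if i.testBit j then β.basis j else 0

/-- The minimal polynomial of `β_{2^L}` over `GF(2)`. -/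
def modulus : (ZMod 2)[X] := minpoly (ZMod 2) β.gen

/-- The quotient of `x ^ (2 * 2 ^ L)` by the minimal polynomial of `β_{2^L}`. -/
def modulusInv : (ZMod 2)[X] := (X ^ (2 * 2 ^ L)) /ₘ β.modulus

open Classical in
/-- The polynomial of degree `< 2 ^ L` over `GF(2)` whose value at `β_{2^L}` is `c`. -/
def reprPoly (c : GaloisField 2 (2 ^ L)) : (ZMod 2)[X] :=
  Classical.epsilon fun P : (ZMod 2)[X] =>
    P.degree < ((2 ^ L : ℕ) : WithBot ℕ) ∧ aeval β.gen P = c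

end CantorBasis

/-! ### Algorithms over `GF(2)` -/

section BitAlgorithms

variable {B : Type} (o : Ops (ZMod 2) B)

/-- `∑ j < n, j ≤ i, i - j < n`, of `x_j * y_{i-j}` (the sum taken over the first `s` values of `j`). -/
def convSum (n : ℕ) (x y : ℕ → B) (i : ℕ) : ℕ → Costed B
  | 0 => pure o.zero
  | j + 1 => do
    let s ← convSum n x y i j
    if j ≤ i ∧ i - j < n then do
      let p ← o.mul (x j) (y (i - j))
      o.add s p
    else pure s

/-- Schoolbook multiplication of polynomials of degree `< n`. -/
def schoolbook (n : ℕ) (x y : ℕ → B) : Costed (ℕ → B) :=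
  tabulate o.zero (2 * n) fun i => convSum o n x y i n

/-- The array of the coefficients of `x ^ i`, `i < n`, of a fixed polynomial. -/
def constArray (n : ℕ) (P : (ZMod 2)[X]) : ℕ → B :=
  fun j => if j < n then o.const (P.coeff j) else o.zero

/-- Arithmetic of `GF(2 ^ (2 ^ L))` on bits. An element `∑ j < 2 ^ L, x_j * β_{2^L} ^ j` is represented
by the array of the `x_j`. Two elements are multiplied by multiplying the representing polynomials
by `polyMul`, an algorithm for polynomials of degree `< n = 2 ^ L`, and reducing the product `h`
modulo the minimal polynomial `μ = x ^ n + μ'` of `β_{2^L}`. For the reduction, let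
`x ^ n + ν'` be the quotient of `x ^ (2 * n)` by `μ`, and let `h₁` be the quotient of `h` by `x ^ n`;
the quotient of `h` by `μ` is `q = h₁ + (h₁ * ν' / x ^ n)`, and the remainder is
`h - q * μ'` up to terms divisible by `x ^ n`. -/
def fieldOps {L : ℕ} (β : CantorBasis L) (polyMul : (ℕ → B) → (ℕ → B) → Costed (ℕ → B)) :
    Ops (GaloisField 2 (2 ^ L)) (ℕ → B) where
  const c := constArray o (2 ^ L) (β.reprPoly c)
  add x y := tabulate o.zero (2 ^ L) fun j => o.add (x j) (y j)
  mul x y := do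
    let h ← polyMul x y
    let e ← polyMul (fun i => h (2 ^ L + i)) (constArray o (2 ^ L) β.modulusInv)
    let q ← tabulate o.zero (2 ^ L) fun i => o.add (h (2 ^ L + i)) (e (2 ^ L + i))
    let d ← polyMul q (constArray o (2 ^ L) β.modulus)
    tabulate o.zero (2 ^ L) fun i => o.add (h i) (d i)

/-- The special multiplication algorithm `SMA(f, g, m)` for polynomials of degree `< 2 ^ m` over
`GF(2)`, with `L = ⌈log₂ (m + 1)⌉`. The multiplications in `GF(2 ^ (2 ^ L))` apply the algorithm
recursively to the representing polynomials of degree `< 2 ^ L`; if this does not make the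
parameter smaller, that is, for `m = 1, 2`, those polynomials are multiplied directly. -/
def SMA (β : ∀ L, CantorBasis L) (m : ℕ) (f g : ℕ → B) : Costed (ℕ → B) :=
  if m = 0 then do
    let p ← o.mul (f 0) (g 0)
    pure fun i => if i = 0 then p else o.zero
  else
    let L := Nat.clog 2 (m + 1)
    let polyMul : (ℕ → B) → (ℕ → B) → Costed (ℕ → B) := fun x y =>
      if _hL : Nat.clog 2 (m + 1) < m then SMA β (Nat.clog 2 (m + 1)) x y
      else schoolbook o (2 ^ L) x y
    let w := 2 ^ (L - 1)
    let A : ℕ → ℕ → B := fun i j => if j < w then f (w * i + j) else o.zero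
    let A' : ℕ → ℕ → B := fun i j => if j < w then g (w * i + j) else o.zero
    do
      let H ← MA (fieldOps o (β L) polyMul) (β L).elt (m - L + 1) A A'
      tabulate o.zero (2 ^ (m + 1)) fun p =>
        if p < w then pure (H 0 p) else o.add (H (p / w) (p % w)) (H (p / w - 1) (w + p % w))
  termination_by m
  decreasing_by exact _hL

end BitAlgorithms

end

/-! ### Existence of Cantor bases -/

section ArtinSchreier

variable {K : Type*} [Field K]

/-! Existence. The map s(y) = y² - y is additive in characteristic two, and its 2^l-th iterate is
y^(2^(2^l)) - y. On GF(2^n), n = 2^L, the n-th iterate is therefore zero, while the (n-1)-st is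
given by a polynomial of degree 2^(n-1) < 2^n and is not identically zero. If it does not vanish at
x, its value there is a nonzero root of s, that is, 1; the iterates of x then form a Cantor basis
(`nonempty_cantorBasis`).

Correctness. As s moves a Cantor basis down by one index, y ↦ y^(2^k) - y with k a power of two
deletes the k lowest binary digits of the index of ϖ (`elt_pow_add`). It is thus constant on each
block of 2^k consecutive points a + ϖ_u, and a polynomial in Gao–Mateer form becomes on each block a
polynomial of degree < 2^k whose coefficients are values of smaller evaluation problems (`EA_val`,
`IA_val`). Distinctness of the points yields multiplication over the field (`MA_val`). `SMA` packs
blocks of only half the field degree, so a product of two packed polynomials, and hence any sum of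
such products, has degree below that of the minimal polynomial and is recovered from its value at β
(`SMAStep_multipliesBelow`). The algorithms touch their data only through `Ops`, so correctness over
the field passes to its bit representation (`Ops.Represents`).

Cost. A transform of size 2^M needs O(2^M M log M) field additions and O(2^M M) multiplications
(`EA_cost_le`, `IA_cost_le`); a multiplication in the field consists of three polynomial products of
length 2^L and two additions. A bound T(m) for the cost divided by 2^m thus satisfies T(m) ≤ 202 m
(L + T(L)) with L = ⌈log₂(m+1)⌉ (`SMAStep_cost_le`). Induction first gives the crude T(m) =
O((m+1)²) (`exists_SMA_cost_le_quadratic`); inserting it once for T(L) gives O(m (log m)²). -/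

theorem artinSchreier_iterate_two_pow [CharP K 2] (l : ℕ) (x : K) :
    (fun y : K => y ^ 2 - y)^[2 ^ l] x = x ^ 2 ^ 2 ^ l - x := by
  have : Fact (Nat.Prime 2) := ⟨Nat.prime_two⟩
  induction l generalizing x with
  | zero => simp
  | succ l ih =>
    rw [pow_succ 2 l, mul_two, Function.iterate_add_apply, ih, ih, sub_pow_char_pow, ← pow_mul,
      ← pow_add, CharTwo.sub_eq_add, CharTwo.sub_eq_add, CharTwo.sub_eq_add,
      add_assoc, CharTwo.add_cancel_left, ← CharTwo.sub_eq_add]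

/-- The n-th iterate is a polynomial function of degree 2^n, so it cannot vanish on more than 2^n
elements. -/
theorem exists_artinSchreier_iterate_ne_zero [Finite K] {n : ℕ} (h : 2 ^ n < Nat.card K) :
    ∃ x : K, (fun y : K => y ^ 2 - y)^[n] x ≠ 0 := by
  have key : ∀ i : ℕ, ∃ P : K[X], P.natDegree = 2 ^ i ∧
      ∀ x, P.eval x = (fun y : K => y ^ 2 - y)^[i] x := by
    intro i
    induction i with
    | zero => exact ⟨X, by simp, by simp⟩
    | succ i ih =>
      obtain ⟨P, hd, hP⟩ := ih
      refine ⟨P ^ 2 - P, ?_, fun x => ?_⟩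
      · rw [natDegree_sub_eq_left_of_natDegree_lt, natDegree_pow, hd, pow_succ, mul_comm]
        rw [natDegree_pow, hd]
        have := Nat.two_pow_pos i
        omega
      · rw [Function.iterate_succ_apply', ← hP]
        simp
  obtain ⟨P, hd, hP⟩ := key n
  by_contra! hc
  have := Fintype.ofFinite K
  rw [Nat.card_eq_fintype_card] at h
  have h0 : P = 0 := by
    apply Polynomial.eq_zero_of_natDegree_lt_card_of_eval_eq_zero' P Finset.univ
    · intro x _
      rw [hP, hc]
    · rwa [Finset.card_univ, hd]
  rw [h0, natDegree_zero] at hd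
  have := Nat.two_pow_pos n
  omega

end ArtinSchreier

/-- A chain `b (n - 1) ↦ ⋯ ↦ b 0 ↦ 0` of a linear map with `b 0 ≠ 0` is linearly independent. -/
theorem linearIndependent_of_chain {F V : Type*} [Field F] [AddCommGroup V] [Module F V]
    (φ : V →ₗ[F] V) (b : ℕ → V) (h0 : b 0 ≠ 0) (hφ0 : φ (b 0) = 0) (n : ℕ)
    (hφ : ∀ i, i + 1 < n → φ (b (i + 1)) = b i) :
    LinearIndependent F fun i : Fin n => b i := by
  have hle : ∀ d i, d + i < n → (φ ^ d) (b (d + i)) = b i := by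
    intro d
    induction d with
    | zero => intro i _; simp
    | succ d ih =>
      intro i hi
      rw [pow_succ, Module.End.mul_apply, show d + 1 + i = (d + i) + 1 by ring, hφ _ (by omega),
        ih i (by omega)]
  have hlt : ∀ i d, i < n → (φ ^ (i + 1 + d)) (b i) = 0 := by
    intro i d hi
    have : (φ ^ i) (b i) = b 0 := hle i 0 (by omega)
    rw [show i + 1 + d = d + 1 + i by ring, pow_add, Module.End.mul_apply, this, pow_succ,
      Module.End.mul_apply, hφ0, map_zero]
  rw [Fintype.linearIndependent_iff]
  intro c hc
  -- Applying φ^N kills all terms below the top one and sends `b N` to `b 0 ≠ 0`, so the top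
  -- coefficient vanishes; then descend.
  have key : ∀ N, N ≤ n → ∀ c : ℕ → F, ∑ i ∈ Finset.range N, c i • b i = 0 →
      ∀ i < N, c i = 0 := by
    intro N
    induction N with
    | zero => intro _ _ _ i hi; omega
    | succ N ih =>
      intro hN c hs
      have hcN : c N = 0 := by
        have := congrArg (φ ^ N) hs
        rw [Finset.sum_range_succ, map_add, map_sum, Finset.sum_eq_zero, zero_add, map_smul,
          show (φ ^ N) (b N) = b 0 from hle N 0 (by omega), map_zero, smul_eq_zero] at this
        · exact this.resolve_right h0
        · intro i hi
          rw [Finset.mem_range] at hi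
          rw [map_smul, show N = i + 1 + (N - i - 1) by omega, hlt _ _ (by omega), smul_zero]
      intro i hi
      rcases Nat.lt_succ_iff_lt_or_eq.mp hi with h | h
      · refine ih (by omega) c ?_ i h
        rwa [Finset.sum_range_succ, hcN, zero_smul, add_zero] at hs
      · rw [h, hcN]
  intro i
  have := key n le_rfl (fun j => if h : j < n then c ⟨j, h⟩ else 0)
    (by rw [Finset.sum_range]; simpa using hc) i i.2
  simpa using this

theorem nonempty_cantorBasis (L : ℕ) : Nonempty (CantorBasis L) := by
  have : Fact (Nat.Prime 2) := ⟨Nat.prime_two⟩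
  set n := 2 ^ L with hn
  have hn0 : n ≠ 0 := (Nat.two_pow_pos L).ne'
  have hn1 : 1 ≤ n := Nat.one_le_iff_ne_zero.mpr hn0
  set K := GaloisField 2 n
  have hcard : Nat.card K = 2 ^ n := GaloisField.card 2 n hn0
  set s : K → K := fun y => y ^ 2 - y with hs
  obtain ⟨x, hx⟩ := exists_artinSchreier_iterate_ne_zero (K := K) (n := n - 1)
    (by rw [hcard]; exact Nat.pow_lt_pow_right one_lt_two (Nat.sub_lt hn1 one_pos))
  let φ : K →ₗ[ZMod 2] K :=
    (AddMonoidHom.toZModLinearMap 2 ((frobenius K 2).toAddMonoidHom)) - LinearMap.id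
  have hφ : ∀ y, φ y = s y := fun y => by simp [φ, hs, frobenius_def]
  have hz : s (s^[n - 1] x) = 0 := by
    rw [← Function.iterate_succ_apply' s, Nat.succ_eq_add_one, Nat.sub_add_cancel hn1]
    -- The number of iterations is n = 2^L, so the iterate is x^(2^n) - x, which is zero since the
    -- field has 2^n elements.
    refine (artinSchreier_iterate_two_pow L x).trans ?_
    have := Fintype.ofFinite K
    rw [← hn, ← hcard, Nat.card_eq_fintype_card, FiniteField.pow_card, sub_self]
  have hone : s^[n - 1] x = 1 := by
    have : s^[n - 1] x * (s^[n - 1] x - 1) = 0 := by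
      rw [← hz]; simp only [hs]; ring
    rcases mul_eq_zero.mp this with h | h
    · exact absurd h hx
    · exact sub_eq_zero.mp h
  let b : ℕ → K := fun i => s^[n - 1 - i] x
  have hstep : ∀ i, i + 1 < n → s (b (i + 1)) = b i := by
    intro i hi
    simp only [b]
    rw [← Function.iterate_succ_apply' s]
    congr 2
    omega
  have hli := linearIndependent_of_chain φ b (by simpa [b] using hx)
    (by rw [hφ]; simpa [b] using hz) n (fun i hi => by rw [hφ, hstep i hi])
  have : Nonempty (Fin n) := ⟨⟨0, hn1⟩⟩
  let B := basisOfLinearIndependentOfCardEqFinrank hli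
    (by rw [Fintype.card_fin, GaloisField.finrank 2 hn0])
  have hB : ∀ i : Fin n, B i = b i := fun i => by simp [B]
  refine ⟨⟨B, ?_, fun i hi => ?_⟩⟩
  · rw [hB]; simpa [b] using hone
  · rw [hB, hB]; exact hstep i hi

/-! ### Elements of a Cantor basis -/

namespace CantorBasis

variable {L : ℕ} (β : CantorBasis L)

/-- The basis elements as a sequence, continued by zero. -/
noncomputable def seq (j : ℕ) : GaloisField 2 (2 ^ L) :=
  if h : j < 2 ^ L then β.basis ⟨j, h⟩ else 0

theorem elt_eq_sum_range (i : ℕ) :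
    β.elt i = ∑ j ∈ Finset.range (2 ^ L), if i.testBit j then β.seq j else 0 := by
  rw [Finset.sum_range]
  simp [elt, seq]

/-- The left side is the 2^l-fold iterate of y² - y, which goes down one basis element at a time,
and from β_1 = 1 to 0. -/
theorem seq_pow_add (l j : ℕ) (hj : j < 2 ^ L) :
    β.seq j ^ 2 ^ 2 ^ l + β.seq j = if 2 ^ l ≤ j then β.seq (j - 2 ^ l) else 0 := by
  rw [← CharTwo.sub_eq_add, ← artinSchreier_iterate_two_pow]
  have h0 : ∀ d, (fun y : GaloisField 2 (2 ^ L) => y ^ 2 - y)^[d] 0 = 0 := by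
    intro d
    exact Function.iterate_fixed (by simp) d
  have key : ∀ d j, j < 2 ^ L → (fun y => y ^ 2 - y)^[d] (β.seq j) =
      if d ≤ j then β.seq (j - d) else 0 := by
    intro d
    induction d with
    | zero => intro j _; simp
    | succ d ih =>
      intro j hj
      rw [Function.iterate_succ_apply]
      rcases j with _ | j
      · have : β.seq 0 = 1 := by
          rw [seq, dif_pos (Nat.two_pow_pos L)]; exact β.first
        simp [this, h0]
      · have : β.seq (j + 1) ^ 2 - β.seq (j + 1) = β.seq j := by
          rw [seq, seq, dif_pos hj, dif_pos (by omega)]; exact β.step j hj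
        simp only [this]
        rw [ih j (by omega)]
        simp
  exact key _ _ hj

/-- Additivity of the iterated Artin–Schreier map reduces this to basis elements, where it shifts
the binary digits of u down by 2^l. This is the identity on which the recursion of evaluation and
interpolation rests. -/
theorem elt_pow_add (l u : ℕ) (hu : u < 2 ^ 2 ^ L) :
    β.elt u ^ 2 ^ 2 ^ l + β.elt u = β.elt (u / 2 ^ 2 ^ l) := by
  have : Fact (Nat.Prime 2) := ⟨Nat.prime_two⟩
  rw [elt_eq_sum_range, elt_eq_sum_range, sum_pow_char_pow, ← Finset.sum_add_distrib]
  have hbit : ∀ j, (u / 2 ^ 2 ^ l).testBit j = u.testBit (2 ^ l + j) := by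
    intro j
    rw [← Nat.shiftRight_eq_div_pow, Nat.testBit_shiftRight]
  simp only [hbit]
  have h1 : ∀ j ∈ Finset.range (2 ^ L), ((if u.testBit j then β.seq j else 0) ^ 2 ^ 2 ^ l +
      if u.testBit j then β.seq j else 0) =
      if 2 ^ l ≤ j then (if u.testBit j then β.seq (j - 2 ^ l) else 0) else 0 := by
    intro j hj
    by_cases hb : u.testBit j
    · simp only [hb, if_true]
      exact β.seq_pow_add l j (Finset.mem_range.mp hj)
    · simp [hb]
  rw [Finset.sum_congr rfl h1, ← Finset.sum_filter]
  -- Since u has at most 2^L digits, the shifted digit sum may be cut off where the digits of u end.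
  have h2 : ∀ j, 2 ^ L ≤ 2 ^ l + j → u.testBit (2 ^ l + j) = false := fun j hj =>
    Nat.testBit_lt_two_pow (hu.trans_le (Nat.pow_le_pow_right two_pos hj))
  have h3 : ∑ j ∈ Finset.range (2 ^ L), (if u.testBit (2 ^ l + j) then β.seq j else 0) =
      ∑ j ∈ Finset.range (2 ^ L) with 2 ^ l + j < 2 ^ L,
        if u.testBit (2 ^ l + j) then β.seq j else 0 := by
    rw [Finset.sum_filter]
    refine Finset.sum_congr rfl fun j _ => ?_
    split_ifs with h h'
    all_goals first | rfl | simp_all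
  rw [h3]
  have hpos := Nat.two_pow_pos l
  refine Finset.sum_bij' (fun j _ => j - 2 ^ l) (fun j _ => 2 ^ l + j) ?_ ?_ ?_ ?_ ?_
  · intro j hj; simp only [Finset.mem_filter, Finset.mem_range] at hj ⊢; omega
  · intro j hj; simp only [Finset.mem_filter, Finset.mem_range] at hj ⊢; omega
  · intro j hj; simp only [Finset.mem_filter, Finset.mem_range] at hj ⊢; omega
  · intro j hj; simp only [Finset.mem_filter, Finset.mem_range] at hj ⊢; omega
  · intro j hj
    simp only [Finset.mem_filter, Finset.mem_range] at hj
    rw [show 2 ^ l + (j - 2 ^ l) = j by omega]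

/-- The binary digits of i and of j * 2^k occupy disjoint positions, so no carries occur. -/
theorem elt_add_mul (k i j : ℕ) (hi : i < 2 ^ k) :
    β.elt (i + j * 2 ^ k) = β.elt i + β.elt (j * 2 ^ k) := by
  rw [elt, elt, elt, ← Finset.sum_add_distrib]
  refine Finset.sum_congr rfl fun t _ => ?_
  have h1 : (i + j * 2 ^ k).testBit t = if (t : ℕ) < k then i.testBit t else j.testBit (t - k) := by
    rw [add_comm, mul_comm, Nat.testBit_two_pow_mul_add _ hi]
  have h2 : (j * 2 ^ k).testBit t = if (t : ℕ) < k then false else j.testBit (t - k) := by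
    rw [Nat.testBit_mul_two_pow]
    split_ifs with h
    · simp; omega
    · simp; omega
  rw [h1, h2]
  by_cases h : (t : ℕ) < k
  · simp [h]
  · have : i.testBit t = false :=
      Nat.testBit_lt_two_pow (hi.trans_le (Nat.pow_le_pow_right two_pos (by omega)))
    simp [h, this]

@[simp]
theorem elt_zero : β.elt 0 = 0 := by simp [elt]

theorem elt_one : β.elt 1 = 1 := by
  rw [elt_eq_sum_range, Finset.sum_eq_single 0]
  · simp only [Nat.testBit_zero]
    rw [seq, dif_pos (Nat.two_pow_pos L)]
    simpa using β.first
  · intro j _ hj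
    simp [Nat.testBit_one_eq_true_iff_self_eq_zero, hj]
  · simp

theorem elt_injOn {u v : ℕ} (hu : u < 2 ^ 2 ^ L) (hv : v < 2 ^ 2 ^ L) (h : β.elt u = β.elt v) :
    u = v := by
  have hrepr : ∀ (i : ℕ) (j : Fin (2 ^ L)), β.basis.repr (β.elt i) j =
      if i.testBit j then 1 else 0 := by
    intro i j
    have : β.elt i = ∑ j : Fin (2 ^ L), (if i.testBit j then (1 : ZMod 2) else 0) • β.basis j := by
      simp [elt]
    rw [this, β.basis.repr_sum_self]
  apply Nat.eq_of_testBit_eq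
  intro j
  by_cases hj : j < 2 ^ L
  · have := hrepr u ⟨j, hj⟩
    rw [h, hrepr] at this
    revert this
    cases u.testBit j <;> cases v.testBit j <;> simp
  · have : ∀ w, w < 2 ^ 2 ^ L → w.testBit j = false := fun w hw =>
      Nat.testBit_lt_two_pow (hw.trans_le (Nat.pow_le_pow_right two_pos (by omega)))
    rw [this u hu, this v hv]

/-- Each basis element is a polynomial in the next one, by β_{i-1} = β_i² - β_i; descend from the
last. Hence the last element generates the field and its minimal polynomial has degree 2^L. -/
theorem basis_mem_adjoin_gen (j : Fin (2 ^ L)) :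
    β.basis j ∈ Algebra.adjoin (ZMod 2) {β.gen} := by
  have key : ∀ d (h : d < 2 ^ L),
      β.basis ⟨2 ^ L - 1 - d, by omega⟩ ∈ Algebra.adjoin (ZMod 2) {β.gen} := by
    intro d
    induction d with
    | zero => intro h; exact Algebra.subset_adjoin rfl
    | succ d ih =>
      intro h
      have hs := β.step (2 ^ L - 1 - (d + 1)) (by omega)
      rw [← hs]
      have he : (⟨2 ^ L - 1 - (d + 1) + 1, by omega⟩ : Fin (2 ^ L)) = ⟨2 ^ L - 1 - d, by omega⟩ :=
        Fin.ext (by simp; omega)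
      rw [he]
      exact sub_mem (pow_mem (ih (by omega)) 2) (ih (by omega))
  have := key (2 ^ L - 1 - j) (by omega)
  convert this using 3
  omega

theorem adjoin_gen : Algebra.adjoin (ZMod 2) {β.gen} = ⊤ := by
  rw [eq_top_iff]
  intro x _
  rw [← β.basis.sum_repr x]
  exact sum_mem fun j _ => Subalgebra.smul_mem _ (β.basis_mem_adjoin_gen j) _

theorem finrank_eq : Module.finrank (ZMod 2) (GaloisField 2 (2 ^ L)) = 2 ^ L :=
  GaloisField.finrank 2 (Nat.two_pow_pos L).ne'

theorem isIntegral_gen : IsIntegral (ZMod 2) β.gen := Algebra.IsIntegral.isIntegral _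

theorem modulus_monic : β.modulus.Monic := minpoly.monic β.isIntegral_gen

theorem natDegree_modulus : β.modulus.natDegree = 2 ^ L := by
  have h : IntermediateField.adjoin (ZMod 2) {β.gen} = ⊤ := by
    rw [eq_top_iff]
    intro x _
    have : x ∈ Algebra.adjoin (ZMod 2) {β.gen} := by rw [β.adjoin_gen]; trivial
    exact IntermediateField.algebra_adjoin_le_adjoin _ _ this
  rw [modulus, ← IntermediateField.adjoin.finrank β.isIntegral_gen, h,
    IntermediateField.finrank_top', finrank_eq]

theorem degree_modulus : β.modulus.degree = ((2 ^ L : ℕ) : WithBot ℕ) := by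
  rw [degree_eq_natDegree β.modulus_monic.ne_zero, natDegree_modulus]

theorem aeval_modulus : aeval β.gen β.modulus = 0 := minpoly.aeval _ _

theorem exists_aeval_gen (c : GaloisField 2 (2 ^ L)) : ∃ P : (ZMod 2)[X],
    P.degree < ((2 ^ L : ℕ) : WithBot ℕ) ∧ aeval β.gen P = c := by
  have hc : c ∈ Algebra.adjoin (ZMod 2) {β.gen} := by rw [β.adjoin_gen]; trivial
  rw [Algebra.adjoin_singleton_eq_range_aeval] at hc
  obtain ⟨P, hP⟩ := hc
  refine ⟨P %ₘ β.modulus, ?_, ?_⟩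
  · rw [← β.degree_modulus]
    exact degree_modByMonic_lt _ β.modulus_monic
  · rw [modByMonic_eq_sub_mul_div]
    simp only [map_sub, map_mul, aeval_modulus, zero_mul, sub_zero]
    exact hP

theorem reprPoly_spec (c : GaloisField 2 (2 ^ L)) :
    (β.reprPoly c).degree < ((2 ^ L : ℕ) : WithBot ℕ) ∧ aeval β.gen (β.reprPoly c) = c :=
  Classical.epsilon_spec (β.exists_aeval_gen c)

/-- Uniqueness of the representation: the difference would be a nonzero multiple of the minimal
polynomial, of too small degree. It lets products of blocks be read off from field elements. -/
theorem eq_of_aeval_gen_eq {P Q : (ZMod 2)[X]} (hP : P.degree < ((2 ^ L : ℕ) : WithBot ℕ))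
    (hQ : Q.degree < ((2 ^ L : ℕ) : WithBot ℕ)) (h : aeval β.gen P = aeval β.gen Q) : P = Q := by
  rw [← sub_eq_zero]
  by_contra hne
  have h1 := minpoly.degree_le_of_ne_zero (ZMod 2) β.gen hne (by rw [map_sub, h, sub_self])
  have h2 : (P - Q).degree < ((2 ^ L : ℕ) : WithBot ℕ) :=
    (degree_sub_le P Q).trans_lt (max_lt hP hQ)
  have h3 := β.degree_modulus
  rw [modulus] at h3
  rw [h3] at h1
  exact absurd h2 (not_lt.mpr h1)

end CantorBasis

/-! ### Values and simulation -/

namespace Costed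

@[simp] theorem val_pure {α : Type} (a : α) : (pure a : Costed α).val = a := rfl

@[simp] theorem cost_pure {α : Type} (a : α) : (pure a : Costed α).cost = 0 := rfl

@[simp] theorem val_bind {α γ : Type} (x : Costed α) (f : α → Costed γ) :
    (x >>= f).val = (f x.val).val := rfl

@[simp] theorem cost_bind {α γ : Type} (x : Costed α) (f : α → Costed γ) :
    (x >>= f).cost = x.cost + (f x.val).cost := rfl

theorem val_tabulate {α : Type} (d : α) (n : ℕ) (g : ℕ → Costed α) :
    (tabulate d n g).val = fun i => if i < n then (g i).val else d := rfl

theorem val_tabulate_apply {α : Type} (d : α) (n : ℕ) (g : ℕ → Costed α) (i : ℕ) :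
    (tabulate d n g).val i = if i < n then (g i).val else d := rfl

theorem cost_tabulate {α : Type} (d : α) (n : ℕ) (g : ℕ → Costed α) :
    (tabulate d n g).cost = ∑ i ∈ Finset.range n, (g i).cost := rfl

end Costed

open Costed

/-- The operations of `K` on its own elements, free of charge. -/
def valOps (K : Type) [Field K] : Ops K K where
  const c := c
  add x y := ⟨x + y, 0⟩
  mul x y := ⟨x * y, 0⟩

section Simulation

variable {K X : Type} [Field K]

/-- The operations `O` on the data `X` compute in `K`, where `R x c` says that the datum `x`
represents `c`. -/
structure Ops.Represents (O : Ops K X) (R : X → K → Prop) : Prop where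
  const : ∀ c, R (O.const c) c
  add : ∀ {x y a b}, R x a → R y b → R (O.add x y).val (a + b)
  mul : ∀ {x y a b}, R x a → R y b → R (O.mul x y).val (a * b)

variable {O : Ops K X} {R : X → K → Prop}

theorem Ops.Represents.zero (h : O.Represents R) : R O.zero 0 := h.const 0

/-- The default values have to be related as well, because the relation is asserted for all indices,
including those outside the loop. -/
theorem tabulate_rel {α γ : Type} {P : α → γ → Prop} {d : α} {d' : γ} (hd : P d d') (n : ℕ)
    {g : ℕ → Costed α} {g' : ℕ → Costed γ} (hg : ∀ i, P (g i).val (g' i).val) (i : ℕ) :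
    P ((tabulate d n g).val i) ((tabulate d' n g').val i) := by
  simp only [val_tabulate]
  split_ifs
  · exact hg i
  · exact hd

theorem sqIter_represents (h : O.Represents R) (k : ℕ) {x : X} {a : K} (ha : R x a) :
    R (sqIter O k x).val (sqIter (valOps K) k a).val := by
  induction k generalizing x a with
  | zero => exact ha
  | succ k ih => exact ih (h.mul ha ha)

theorem gaoMateer_represents (h : O.Represents R) (k r : ℕ) {f : ℕ → X} {f' : ℕ → K}
    (hf : ∀ i, R (f i) (f' i)) (j i : ℕ) :
    R ((gaoMateer O k r f).val j i) ((gaoMateer (valOps K) k r f').val j i) := by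
  induction r generalizing f f' j with
  | zero =>
    simp only [gaoMateer, val_pure]
    split_ifs
    · exact hf i
    · exact h.zero
  | succ r ih =>
    simp only [gaoMateer, val_bind, val_pure]
    have hh := tabulate_rel (P := R) h.zero ((2 ^ k - 1) * 2 ^ r)
      (g := fun i =>
        if i < 2 ^ r then O.add (f (2 ^ k * 2 ^ r + i)) (f ((2 * 2 ^ k - 1) * 2 ^ r + i))
        else pure (f (2 ^ k * 2 ^ r + i)))
      (g' := fun i =>
        if i < 2 ^ r then
          (valOps K).add (f' (2 ^ k * 2 ^ r + i)) (f' ((2 * 2 ^ k - 1) * 2 ^ r + i))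
        else pure (f' (2 ^ k * 2 ^ r + i)))
      (fun i => by
        split_ifs
        · exact h.add (hf _) (hf _)
        · exact hf _)
    split_ifs
    · refine ih (fun i => tabulate_rel h.zero _ (fun i => ?_) i) j
      split_ifs
      · exact hf i
      · exact h.add (hf i) (hh _)
    · refine ih (fun i => ?_) _
      split_ifs
      · exact hh i
      · exact hf _

theorem gaoMateerInv_represents (h : O.Represents R) (k r : ℕ) {f : ℕ → ℕ → X}
    {f' : ℕ → ℕ → K} (hf : ∀ j i, R (f j i) (f' j i)) (i : ℕ) :
    R ((gaoMateerInv O k r f).val i) ((gaoMateerInv (valOps K) k r f').val i) := by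
  induction r generalizing f f' i with
  | zero => exact hf 0 i
  | succ r ih =>
    simp only [gaoMateerInv, val_bind, val_pure]
    split_ifs
    · refine tabulate_rel h.zero _ (fun i => ?_) i
      split_ifs
      · exact ih hf i
      · exact h.add (ih hf i) (ih (fun j i => hf _ i) _)
    · refine tabulate_rel h.zero _ (fun i => ?_) _
      split_ifs
      · exact h.add (ih (fun j i => hf _ i) _) (ih (fun j i => hf _ i) _)
      · exact ih (fun j i => hf _ i) _

/-- Every datum arises from the inputs and constants by `O.add` and `O.mul`, so the runs over X and
over K stay related step by step; control flow depends on indices only. -/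
theorem EA_represents (h : O.Represents R) (ϖ : ℕ → K) (m : ℕ) {f : ℕ → X} {f' : ℕ → K}
    {x : X} {a : K} (hf : ∀ i, R (f i) (f' i)) (ha : R x a) (i : ℕ) :
    R ((EA O ϖ m f x).val i) ((EA (valOps K) ϖ m f' a).val i) := by
  induction m using Nat.strong_induction_on generalizing f f' x a i with
  | _ m ih =>
    rw [EA, EA]
    split_ifs with hm
    · simp only [val_bind, val_pure]
      have h0 := h.add (hf 0) (h.mul (hf 1) ha)
      split_ifs
      · exact h0
      · exact h.add h0 (hf 1)
      · exact h.zero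
    · simp only [val_bind, val_pure, RA]
      refine tabulate_rel (P := fun (y : ℕ → X) (c : ℕ → K) => ∀ i, R (y i) (c i)) (fun _ => h.zero) _
        (fun j => ?_) _ _
      refine ih _ (splitPoint_lt hm) (fun i => ?_) (h.add ha (h.const _))
      refine tabulate_rel (P := fun (y : ℕ → X) (c : ℕ → K) => ∀ i, R (y i) (c i)) (fun _ => h.zero) _
        (fun i' => ?_) _ _
      exact ih _ (sub_splitPoint_lt hm) (fun j => gaoMateer_represents h _ _ hf _ _)
        (h.add (sqIter_represents h _ ha) ha)

theorem IA_represents (h : O.Represents R) (ϖ : ℕ → K) (m : ℕ) {v : ℕ → X} {v' : ℕ → K}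
    {x : X} {a : K} (hv : ∀ i, R (v i) (v' i)) (ha : R x a) (i : ℕ) :
    R ((IA O ϖ m v x).val i) ((IA (valOps K) ϖ m v' a).val i) := by
  induction m using Nat.strong_induction_on generalizing v v' x a i with
  | _ m ih =>
    rw [IA, IA]
    split_ifs with hm
    · simp only [val_bind, val_pure]
      have h0 := h.add (hv 0) (hv 1)
      split_ifs
      · exact h.add (hv 0) (h.mul ha h0)
      · exact h0
      · exact h.zero
    · simp only [val_bind, DRA]
      refine gaoMateerInv_represents h _ _ (fun j i => ?_) _
      refine tabulate_rel (P := fun (y : ℕ → X) (c : ℕ → K) => ∀ i, R (y i) (c i)) (fun _ => h.zero) _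
        (fun i => ?_) _ _
      refine ih _ (sub_splitPoint_lt hm) (fun j => ?_) (h.add (sqIter_represents h _ ha) ha)
      refine tabulate_rel (P := fun (y : ℕ → X) (c : ℕ → K) => ∀ i, R (y i) (c i)) (fun _ => h.zero) _
        (fun j => ?_) _ _
      exact ih _ (splitPoint_lt hm) (fun i => hv _) (h.add ha (h.const _))

theorem MA_represents (h : O.Represents R) (ϖ : ℕ → K) (m : ℕ) {f g : ℕ → X} {f' g' : ℕ → K}
    (hf : ∀ i, R (f i) (f' i)) (hg : ∀ i, R (g i) (g' i)) (i : ℕ) :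
    R ((MA O ϖ m f g).val i) ((MA (valOps K) ϖ m f' g').val i) := by
  simp only [MA, val_bind]
  refine IA_represents h ϖ _ (fun i => ?_) h.zero i
  exact tabulate_rel h.zero _ (fun i => h.mul (EA_represents h ϖ _ hf h.zero i)
    (EA_represents h ϖ _ hg h.zero i)) i

end Simulation

/-! ### Correctness of evaluation, interpolation and multiplication -/

section Correctness

variable {K : Type} [Field K]

@[simp] theorem valOps_add_val (x y : K) : ((valOps K).add x y).val = x + y := rfl

@[simp] theorem valOps_mul_val (x y : K) : ((valOps K).mul x y).val = x * y := rfl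

@[simp] theorem valOps_const (x : K) : (valOps K).const x = x := rfl

@[simp] theorem valOps_zero : (valOps K).zero = 0 := rfl

theorem sqIter_val (k : ℕ) (a : K) : (sqIter (valOps K) k a).val = a ^ 2 ^ k := by
  induction k generalizing a with
  | zero => simp [sqIter]
  | succ k ih =>
    simp only [sqIter, val_bind, ih, valOps_mul_val]
    rw [← sq, ← pow_mul, pow_succ, mul_comm]

theorem sum_range_mul_pow_add (f : ℕ → K) (x : K) (n m : ℕ) :
    ∑ i ∈ Finset.range (n + m), f i * x ^ i =
      ∑ i ∈ Finset.range n, f i * x ^ i + x ^ n * ∑ i ∈ Finset.range m, f (n + i) * x ^ i := by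
  rw [Finset.sum_range_add, Finset.mul_sum]
  congr 1
  exact Finset.sum_congr rfl fun i _ => by rw [pow_add]; ring

theorem sum_range_ite_lt_add (f g : ℕ → K) (x : K) {s n : ℕ} (hs : s ≤ n) :
    ∑ i ∈ Finset.range n, (if i < s then f i + g i else f i) * x ^ i =
      ∑ i ∈ Finset.range n, f i * x ^ i + ∑ i ∈ Finset.range s, g i * x ^ i := by
  obtain ⟨d, rfl⟩ := Nat.exists_eq_add_of_le hs
  rw [sum_range_mul_pow_add, sum_range_mul_pow_add f]
  have h1 : ∑ i ∈ Finset.range s, (if i < s then f i + g i else f i) * x ^ i =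
      ∑ i ∈ Finset.range s, f i * x ^ i + ∑ i ∈ Finset.range s, g i * x ^ i := by
    rw [← Finset.sum_add_distrib]
    refine Finset.sum_congr rfl fun i hi => ?_
    rw [if_pos (Finset.mem_range.mp hi), add_mul]
  rw [h1]
  simp only [Nat.not_lt.mpr (Nat.le_add_right s _), if_false]
  ring

theorem sum_range_ite_ge_add (f g : ℕ → K) (x : K) (s n : ℕ) :
    ∑ i ∈ Finset.range (n + s), (if i < s then f i else f i + g (i - s)) * x ^ i =
      ∑ i ∈ Finset.range (n + s), f i * x ^ i + x ^ s * ∑ i ∈ Finset.range n, g i * x ^ i := by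
  rw [add_comm n s, sum_range_mul_pow_add, sum_range_mul_pow_add f]
  have h1 : ∑ i ∈ Finset.range s, (if i < s then f i else f i + g (i - s)) * x ^ i =
      ∑ i ∈ Finset.range s, f i * x ^ i :=
    Finset.sum_congr rfl fun i hi => by rw [if_pos (Finset.mem_range.mp hi)]
  rw [h1]
  simp only [Nat.not_lt.mpr (Nat.le_add_right s _), if_false, Nat.add_sub_cancel_left, add_mul,
    Finset.sum_add_distrib]
  ring

theorem sum_range_congr_mul_pow {f g : ℕ → K} {n : ℕ} (h : ∀ i < n, f i = g i) (x : K) :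
    ∑ i ∈ Finset.range n, f i * x ^ i = ∑ i ∈ Finset.range n, g i * x ^ i :=
  Finset.sum_congr rfl fun i hi => by rw [h i (Finset.mem_range.mp hi)]

/-- Lengths of the pieces in a Gao–Mateer step, with t = 2^k and s = 2^r: the upper half of f splits
into f₁ of length (t-1)s and f₂ of length s. As t ≥ 2, f₂ is no longer than f₁. -/
theorem two_pow_mul_two_pow_split {k : ℕ} (hk : 1 ≤ k) (r : ℕ) :
    2 ^ k * 2 ^ r = (2 ^ k - 1) * 2 ^ r + 2 ^ r ∧
    (2 * 2 ^ k - 1) * 2 ^ r = 2 ^ k * 2 ^ r + (2 ^ k - 1) * 2 ^ r ∧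
    2 ^ r ≤ (2 ^ k - 1) * 2 ^ r := by
  have h2 : 2 ≤ 2 ^ k := by
    calc 2 = 2 ^ 1 := rfl
      _ ≤ 2 ^ k := Nat.pow_le_pow_right two_pos hk
  obtain ⟨d, hd⟩ := Nat.exists_eq_add_of_le h2
  rw [hd]
  refine ⟨?_, ?_, ?_⟩
  · rw [show 2 + d - 1 = d + 1 by omega]; ring
  · rw [show 2 + d - 1 = d + 1 by omega, show 2 * (2 + d) - 1 = 2 * d + 3 by omega]; ring
  · exact Nat.le_mul_of_pos_left _ (by omega)

variable [CharP K 2]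

theorem add_pow_two_pow_pow (x : K) (t r : ℕ) :
    (x ^ t + x) ^ 2 ^ r = x ^ (t * 2 ^ r) + x ^ 2 ^ r := by
  have : Fact (Nat.Prime 2) := ⟨Nat.prime_two⟩
  rw [add_pow_char_pow, pow_mul]

/-- Since s = 2^r is a power of the characteristic, (x^t + x)^s = x^(ts) + x^s, so one splitting
step is division by a binomial. -/
theorem gaoMateer_sum {k : ℕ} (hk : 1 ≤ k) (r : ℕ) (f : ℕ → K) (x : K) :
    ∑ j ∈ Finset.range (2 ^ r), (∑ i ∈ Finset.range (2 ^ k),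
      (gaoMateer (valOps K) k r f).val j i * x ^ i) * (x ^ 2 ^ k + x) ^ j =
    ∑ i ∈ Finset.range (2 ^ k * 2 ^ r), f i * x ^ i := by
  induction r generalizing f with
  | zero => simp [gaoMateer]
  | succ r ih =>
    obtain ⟨h1, h2, h3⟩ := two_pow_mul_two_pow_split hk r
    rw [pow_succ 2 r, mul_two, sum_range_mul_pow_add]
    simp only [gaoMateer, val_bind, val_pure]
    set h : ℕ → K := (tabulate (valOps K).zero ((2 ^ k - 1) * 2 ^ r) fun i =>
        if i < 2 ^ r then
          (valOps K).add (f (2 ^ k * 2 ^ r + i)) (f ((2 * 2 ^ k - 1) * 2 ^ r + i))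
        else pure (f (2 ^ k * 2 ^ r + i))).val with hh
    set g₀ : ℕ → K := (tabulate (valOps K).zero (2 ^ k * 2 ^ r) fun i =>
      if i < 2 ^ r then pure (f i) else (valOps K).add (f i) (h (i - 2 ^ r))).val with hg₀
    set g₁ : ℕ → K := fun i =>
      if i < (2 ^ k - 1) * 2 ^ r then h i else f (2 ^ k * 2 ^ r + i) with hg₁
    have e0 : ∑ j ∈ Finset.range (2 ^ r), (∑ i ∈ Finset.range (2 ^ k),
        (if j < 2 ^ r then (gaoMateer (valOps K) k r g₀).val j
          else (gaoMateer (valOps K) k r g₁).val (j - 2 ^ r)) i * x ^ i) * (x ^ 2 ^ k + x) ^ j =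
        ∑ i ∈ Finset.range (2 ^ k * 2 ^ r), g₀ i * x ^ i := by
      rw [← ih g₀]
      refine sum_range_congr_mul_pow (fun j hj => ?_) _
      simp only [if_pos hj]
    rw [e0]
    simp only [Nat.not_lt.mpr (Nat.le_add_right _ _), if_false, Nat.add_sub_cancel_left]
    rw [ih g₁, add_pow_two_pow_pow]
    have eh : ∑ i ∈ Finset.range ((2 ^ k - 1) * 2 ^ r), h i * x ^ i =
        ∑ i ∈ Finset.range ((2 ^ k - 1) * 2 ^ r), f (2 ^ k * 2 ^ r + i) * x ^ i +
        ∑ i ∈ Finset.range (2 ^ r), f (2 ^ k * 2 ^ r + ((2 ^ k - 1) * 2 ^ r + i)) * x ^ i := by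
      rw [← sum_range_ite_lt_add _ _ _ h3]
      refine sum_range_congr_mul_pow (fun i hi => ?_) _
      simp only [hh, val_tabulate, if_pos hi, h2, ← add_assoc]
      split_ifs <;> simp
    have eg₀ : ∑ i ∈ Finset.range (2 ^ k * 2 ^ r), g₀ i * x ^ i =
        ∑ i ∈ Finset.range (2 ^ k * 2 ^ r), f i * x ^ i +
        x ^ 2 ^ r * ∑ i ∈ Finset.range ((2 ^ k - 1) * 2 ^ r), h i * x ^ i := by
      rw [h1, ← sum_range_ite_ge_add, ← h1]
      refine sum_range_congr_mul_pow (fun i hi => ?_) _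
      simp only [hg₀, val_tabulate, if_pos hi]
      split_ifs <;> simp
    have eg₁ : ∑ i ∈ Finset.range (2 ^ k * 2 ^ r), g₁ i * x ^ i =
        ∑ i ∈ Finset.range ((2 ^ k - 1) * 2 ^ r), h i * x ^ i + x ^ ((2 ^ k - 1) * 2 ^ r) *
        ∑ i ∈ Finset.range (2 ^ r), f (2 ^ k * 2 ^ r + ((2 ^ k - 1) * 2 ^ r + i)) * x ^ i := by
      nth_rw 1 [h1]
      rw [sum_range_mul_pow_add]
      congr 1
      · refine sum_range_congr_mul_pow (fun i hi => ?_) _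
        simp only [hg₁, if_pos hi]
      · simp only [hg₁, Nat.not_lt.mpr (Nat.le_add_right _ _), if_false]
    have ef : ∑ i ∈ Finset.range (2 ^ k * (2 ^ r + 2 ^ r)), f i * x ^ i =
        ∑ i ∈ Finset.range (2 ^ k * 2 ^ r), f i * x ^ i + x ^ (2 ^ k * 2 ^ r) *
        (∑ i ∈ Finset.range ((2 ^ k - 1) * 2 ^ r), f (2 ^ k * 2 ^ r + i) * x ^ i +
          x ^ ((2 ^ k - 1) * 2 ^ r) *
          ∑ i ∈ Finset.range (2 ^ r),
            f (2 ^ k * 2 ^ r + ((2 ^ k - 1) * 2 ^ r + i)) * x ^ i) := by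
      rw [mul_add, sum_range_mul_pow_add, ← sum_range_mul_pow_add (fun i => f (2 ^ k * 2 ^ r + i)),
        ← h1]
    rw [ef, eg₀, eg₁, eh]
    have e2 : (2 : K) = 0 := CharTwo.two_eq_zero
    have ex : x ^ (2 ^ k * 2 ^ r) = x ^ ((2 ^ k - 1) * 2 ^ r) * x ^ 2 ^ r := by
      rw [h1, pow_add]
    rw [ex]
    generalize x ^ ((2 ^ k - 1) * 2 ^ r) = u
    generalize x ^ 2 ^ r = w
    generalize ∑ i ∈ Finset.range ((2 ^ k - 1) * 2 ^ r), f (2 ^ k * 2 ^ r + i) * x ^ i = F₁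
    generalize ∑ i ∈ Finset.range (2 ^ r),
      f (2 ^ k * 2 ^ r + ((2 ^ k - 1) * 2 ^ r + i)) * x ^ i = F₂
    -- With u = x^((t-1)s) and w = x^s, the surplus terms w F₁, w F₂ and u w F₂ each occur exactly
    -- twice.
    linear_combination (w * F₁ + w * F₂ + u * w * F₂) * e2

/-- In g₀ + (x^(ts) + x^s) g₁ the product x^s g₁ straddles the exponent ts: the lowest (t-1)s
coefficients of g₁ go into the lower half, the top s ones wrap into the upper half because x^s
x^((t-1)s) = x^(ts). -/
theorem gaoMateerInv_sum {k : ℕ} (hk : 1 ≤ k) (r : ℕ) (h : ℕ → ℕ → K) (x : K) :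
    ∑ i ∈ Finset.range (2 ^ k * 2 ^ r), (gaoMateerInv (valOps K) k r h).val i * x ^ i =
    ∑ j ∈ Finset.range (2 ^ r),
      (∑ i ∈ Finset.range (2 ^ k), h j i * x ^ i) * (x ^ 2 ^ k + x) ^ j := by
  induction r generalizing h with
  | zero => simp [gaoMateerInv]
  | succ r ih =>
    obtain ⟨h1, h2, h3⟩ := two_pow_mul_two_pow_split hk r
    rw [pow_succ 2 r, mul_two, mul_add, sum_range_mul_pow_add, sum_range_mul_pow_add, ← ih h]
    have := ih fun j => h (2 ^ r + j)
    rw [← this, add_pow_two_pow_pow]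
    simp only [gaoMateerInv, val_bind, val_pure, add_comm _ (2 ^ r)]
    set g₀ := (gaoMateerInv (valOps K) k r h).val
    set g₁ := (gaoMateerInv (valOps K) k r fun j => h (2 ^ r + j)).val
    simp only [Nat.not_lt.mpr (Nat.le_add_right _ _), if_false, Nat.add_sub_cancel_left]
    have elo := sum_range_ite_ge_add g₀ g₁ x (2 ^ r) ((2 ^ k - 1) * 2 ^ r)
    have ehi := sum_range_ite_lt_add g₁ (fun i => g₁ ((2 ^ k - 1) * 2 ^ r + i)) x
      (show 2 ^ r ≤ 2 ^ k * 2 ^ r by omega)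
    have eg := sum_range_mul_pow_add g₁ x ((2 ^ k - 1) * 2 ^ r) (2 ^ r)
    rw [← h1] at elo eg
    have e2 : (2 : K) = 0 := CharTwo.two_eq_zero
    have ex : x ^ (2 ^ k * 2 ^ r) = x ^ ((2 ^ k - 1) * 2 ^ r) * x ^ 2 ^ r := by
      rw [h1, pow_add]
    have key : ∀ {lo hi : ℕ → K},
        (∀ i < 2 ^ k * 2 ^ r, lo i = if i < 2 ^ r then g₀ i else g₀ i + g₁ (i - 2 ^ r)) →
        (∀ i < 2 ^ k * 2 ^ r, hi i =
          if i < 2 ^ r then g₁ i + g₁ ((2 ^ k - 1) * 2 ^ r + i) else g₁ i) →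
        ∑ i ∈ Finset.range (2 ^ k * 2 ^ r), lo i * x ^ i + x ^ (2 ^ k * 2 ^ r) *
          ∑ i ∈ Finset.range (2 ^ k * 2 ^ r), hi i * x ^ i =
        ∑ i ∈ Finset.range (2 ^ k * 2 ^ r), g₀ i * x ^ i + (x ^ (2 ^ k * 2 ^ r) + x ^ 2 ^ r) *
          ∑ i ∈ Finset.range (2 ^ k * 2 ^ r), g₁ i * x ^ i := by
      intro lo hi hlo hhi
      rw [sum_range_congr_mul_pow hlo, sum_range_congr_mul_pow hhi, elo, ehi, eg, ex]
      ring
    apply key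
    · intro i hi
      simp only [if_pos hi, val_tabulate]
      split_ifs <;> simp
    · intro i hi
      simp only [if_pos hi, val_tabulate, add_comm i]
      split_ifs <;> simp

end Correctness

theorem one_le_splitPoint (m : ℕ) : 1 ≤ splitPoint m := Nat.one_le_two_pow

/-! ### Evaluation and interpolation at the points of a Cantor basis -/

section CantorEvaluation

variable {L : ℕ} (β : CantorBasis L)

/-- All points with the same quotient u / 2^k have the same image b + ϖ_{u / 2^k} under x^(2^k) + x.
The inner calls give the values of the Gao–Mateer polynomials there, the outer ones evaluate the
resulting remainder. The bound m ≤ 2^L keeps u in the range where `elt_pow_add` applies. -/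
theorem EA_val (m : ℕ) (h1 : 1 ≤ m) (hm : m ≤ 2 ^ L) (f : ℕ → GaloisField 2 (2 ^ L))
    (a : GaloisField 2 (2 ^ L)) (u : ℕ) (hu : u < 2 ^ m) :
    (EA (valOps _) β.elt m f a).val u = ∑ i ∈ Finset.range (2 ^ m), f i * (a + β.elt u) ^ i := by
  induction m using Nat.strong_induction_on generalizing f a u with
  | _ m ih =>
    rw [EA]
    split_ifs with hm1
    · obtain rfl : m = 1 := by omega
      simp only [val_bind, val_pure, valOps_add_val, valOps_mul_val, pow_one,
        Finset.sum_range_succ, Finset.sum_range_zero]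
      have hu' : u = 0 ∨ u = 1 := by omega
      rcases hu' with rfl | rfl
      · simp
      · simp [β.elt_one]; ring
    · have hk := one_le_splitPoint m
      have hlt := splitPoint_lt hm1
      have hul := hu.trans_le (Nat.pow_le_pow_right two_pos hm)
      simp only [val_bind, val_pure, RA, sqIter_val, valOps_add_val, valOps_const]
      set k := splitPoint m with hkdef
      have hpow : 2 ^ m = 2 ^ k * 2 ^ (m - k) := by rw [← pow_add]; congr 1; omega
      have hq : u / 2 ^ k < 2 ^ (m - k) := Nat.div_lt_of_lt_mul (hpow ▸ hu)
      have hr : u % 2 ^ k < 2 ^ k := Nat.mod_lt _ (Nat.two_pow_pos k)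
      have hsplit : β.elt u = β.elt (u / 2 ^ k * 2 ^ k) + β.elt (u % 2 ^ k) := by
        rw [add_comm, ← β.elt_add_mul k _ _ hr, mul_comm, Nat.mod_add_div]
      -- Here k = 2^(⌈log₂ m⌉ - 1) being itself a power of two is essential.
      have hb : (a + β.elt u) ^ 2 ^ k + (a + β.elt u) = a ^ 2 ^ k + a + β.elt (u / 2 ^ k) := by
        have hϖ : β.elt u ^ 2 ^ k + β.elt u = β.elt (u / 2 ^ k) :=
          β.elt_pow_add (Nat.clog 2 m - 1) u hul
        have : Fact (Nat.Prime 2) := ⟨Nat.prime_two⟩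
        rw [add_pow_char_pow, ← hϖ]
        ring
      rw [hpow, ← gaoMateer_sum hk, hb, val_tabulate]
      simp only [if_pos hq, val_bind, valOps_add_val]
      rw [ih k hlt hk (by omega) _ _ _ hr, add_assoc, ← hsplit]
      simp only [Finset.sum_mul]
      rw [Finset.sum_comm]
      refine Finset.sum_congr rfl fun i hi => ?_
      rw [val_tabulate]
      simp only [if_pos (Finset.mem_range.mp hi)]
      rw [ih (m - k) (by omega) (by omega) (by omega) _ _ _ hq, Finset.sum_mul]
      exact Finset.sum_congr rfl fun j _ => by ring

/-- The same identity read backwards. The output is characterised by its values, so uniqueness of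
interpolation is not needed until `MA_val`. -/
theorem IA_val (m : ℕ) (h1 : 1 ≤ m) (hm : m ≤ 2 ^ L) (v : ℕ → GaloisField 2 (2 ^ L))
    (a : GaloisField 2 (2 ^ L)) (u : ℕ) (hu : u < 2 ^ m) :
    ∑ i ∈ Finset.range (2 ^ m), (IA (valOps _) β.elt m v a).val i * (a + β.elt u) ^ i = v u := by
  induction m using Nat.strong_induction_on generalizing v a u with
  | _ m ih =>
    rw [IA]
    split_ifs with hm1
    · obtain rfl : m = 1 := by omega
      simp only [val_bind, val_pure, valOps_add_val, valOps_mul_val, pow_one,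
        Finset.sum_range_succ, Finset.sum_range_zero]
      have hu' : u = 0 ∨ u = 1 := by omega
      have e2 : (2 : GaloisField 2 (2 ^ L)) = 0 := CharTwo.two_eq_zero
      rcases hu' with rfl | rfl
      · simp only [if_true, if_false, one_ne_zero, pow_zero, CantorBasis.elt_zero]
        linear_combination (a * (v 0 + v 1)) * e2
      · simp only [if_true, if_false, one_ne_zero, pow_zero, CantorBasis.elt_one]
        linear_combination (a * (v 0 + v 1) + v 0) * e2
    · have hk := one_le_splitPoint m
      have hlt := splitPoint_lt hm1
      have hul := hu.trans_le (Nat.pow_le_pow_right two_pos hm)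
      simp only [val_bind, DRA, sqIter_val, valOps_add_val, valOps_const]
      set k := splitPoint m with hkdef
      have hpow : 2 ^ m = 2 ^ k * 2 ^ (m - k) := by rw [← pow_add]; congr 1; omega
      have hq : u / 2 ^ k < 2 ^ (m - k) := Nat.div_lt_of_lt_mul (hpow ▸ hu)
      have hr : u % 2 ^ k < 2 ^ k := Nat.mod_lt _ (Nat.two_pow_pos k)
      have hsplit : β.elt u = β.elt (u / 2 ^ k * 2 ^ k) + β.elt (u % 2 ^ k) := by
        rw [add_comm, ← β.elt_add_mul k _ _ hr, mul_comm, Nat.mod_add_div]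
      have hb : (a + β.elt u) ^ 2 ^ k + (a + β.elt u) = a ^ 2 ^ k + a + β.elt (u / 2 ^ k) := by
        have hϖ : β.elt u ^ 2 ^ k + β.elt u = β.elt (u / 2 ^ k) :=
          β.elt_pow_add (Nat.clog 2 m - 1) u hul
        have : Fact (Nat.Prime 2) := ⟨Nat.prime_two⟩
        rw [add_pow_char_pow, ← hϖ]
        ring
      set T := (tabulate (fun _ => (valOps (GaloisField 2 (2 ^ L))).zero) (2 ^ (m - k)) fun j =>
        (valOps (GaloisField 2 (2 ^ L))).add a (β.elt (j * 2 ^ k)) >>= fun a_j =>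
          IA (valOps _) β.elt k (fun i => v (i + j * 2 ^ k)) a_j).val with hT
      have hTu : T (u / 2 ^ k) = (IA (valOps _) β.elt k (fun i => v (i + u / 2 ^ k * 2 ^ k))
          (a + β.elt (u / 2 ^ k * 2 ^ k))).val := by
        simp only [hT, val_tabulate, if_pos hq, val_bind, valOps_add_val]
      have hv : ∑ i ∈ Finset.range (2 ^ k), T (u / 2 ^ k) i * (a + β.elt u) ^ i = v u := by
        have := ih k hlt hk (by omega) (fun i => v (i + u / 2 ^ k * 2 ^ k))
          (a + β.elt (u / 2 ^ k * 2 ^ k)) _ hr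
        rw [hTu, hsplit, ← add_assoc, this, mul_comm, Nat.mod_add_div]
      rw [hpow, gaoMateerInv_sum hk, hb, ← hv]
      simp only [Finset.sum_mul]
      rw [Finset.sum_comm]
      refine Finset.sum_congr rfl fun i hi => ?_
      rw [← ih (m - k) (by omega) (by omega) (by omega) (fun j => T j i) (a ^ 2 ^ k + a) _ hq,
        Finset.sum_mul]
      refine Finset.sum_congr rfl fun j _ => ?_
      rw [val_tabulate]
      simp only [if_pos (Finset.mem_range.mp hi)]
      ring

/-- The output polynomial W and P * Q both have degree < 2^(m+1) and agree at the 2^(m+1) points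
ϖ_u, which are distinct because m + 1 ≤ 2^L. -/
theorem MA_val (m : ℕ) (hm : m + 1 ≤ 2 ^ L) {P Q : (GaloisField 2 (2 ^ L))[X]}
    (hP : P.degree < ((2 ^ m : ℕ) : WithBot ℕ)) (hQ : Q.degree < ((2 ^ m : ℕ) : WithBot ℕ))
    (i : ℕ) (hi : i < 2 ^ (m + 1)) :
    (MA (valOps _) β.elt m P.coeff Q.coeff).val i = (P * Q).coeff i := by
  have hev : ∀ {P : (GaloisField 2 (2 ^ L))[X]}, P.degree < ((2 ^ m : ℕ) : WithBot ℕ) →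
      ∀ x, ∑ i ∈ Finset.range (2 ^ (m + 1)), P.coeff i * x ^ i = P.eval x := by
    intro P hP x
    rw [eval_eq_sum_range' (lt_of_le_of_lt (natDegree_le_of_degree_le (n := 2 ^ m) hP.le)
      (Nat.pow_lt_pow_right one_lt_two (Nat.lt_succ_self m)))]
  set W : (GaloisField 2 (2 ^ L))[X] :=
    ∑ i ∈ Finset.range (2 ^ (m + 1)), C ((MA (valOps _) β.elt m P.coeff Q.coeff).val i) * X ^ i
    with hW
  have hWc : W.coeff i = (MA (valOps _) β.elt m P.coeff Q.coeff).val i := by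
    rw [hW, finsetSum_coeff]
    simp only [coeff_C_mul_X_pow]
    rw [Finset.sum_ite_eq, if_pos (Finset.mem_range.mpr hi)]
  have hWd : W.degree < ((2 ^ (m + 1) : ℕ) : WithBot ℕ) := by
    refine (degree_sum_le _ _).trans_lt ((Finset.sup_lt_iff (WithBot.bot_lt_coe _)).mpr ?_)
    intro j hj
    exact (degree_C_mul_X_pow_le _ _).trans_lt (by exact_mod_cast Finset.mem_range.mp hj)
  have hPQ : (P * Q).degree < ((2 ^ (m + 1) : ℕ) : WithBot ℕ) := by
    by_cases h0 : P * Q = 0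
    · rw [h0, degree_zero]; exact WithBot.bot_lt_coe _
    have hP0 : P ≠ 0 := left_ne_zero_of_mul h0
    have hQ0 : Q ≠ 0 := right_ne_zero_of_mul h0
    rw [degree_eq_natDegree hP0] at hP
    rw [degree_eq_natDegree hQ0] at hQ
    rw [degree_eq_natDegree h0, natDegree_mul hP0 hQ0]
    norm_cast at hP hQ ⊢
    rw [pow_succ]
    omega
  rw [← hWc]
  congr 1
  refine eq_of_degrees_lt_of_eval_index_eq (Finset.range (2 ^ (m + 1))) (v := β.elt)
    (fun u hu v hv h => ?_) (by simpa using hWd) (by simpa using hPQ) (fun u hu => ?_)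
  · have := Nat.pow_le_pow_right two_pos hm
    simp only [Finset.coe_range, Set.mem_Iio] at hu hv
    exact β.elt_injOn (hu.trans_le this) (hv.trans_le this) h
  · rw [Finset.mem_range] at hu
    have h := IA_val β (m + 1) (by omega) hm
      (tabulate (valOps (GaloisField 2 (2 ^ L))).zero (2 ^ (m + 1)) fun i =>
        (valOps _).mul ((EA (valOps _) β.elt (m + 1) P.coeff (valOps _).zero).val i)
          ((EA (valOps _) β.elt (m + 1) Q.coeff (valOps _).zero).val i)).val 0 u hu
    rw [zero_add, val_tabulate] at h
    simp only [if_pos hu, valOps_mul_val] at h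
    rw [EA_val β _ (by omega) hm _ _ _ hu, EA_val β _ (by omega) hm _ _ _ hu, valOps_zero,
      zero_add, hev hP, hev hQ] at h
    rw [eval_mul, ← h, hW, eval_finsetSum]
    refine Finset.sum_congr rfl fun i _ => ?_
    rw [eval_mul, eval_C, eval_pow, eval_X]
    rfl

end CantorEvaluation

/-! ### Auxiliary facts on polynomials -/

theorem degree_mul_lt_add {F : Type*} [Field F] {P Q : F[X]} {a b : ℕ}
    (hP : P.degree ≤ (a : WithBot ℕ)) (hQ : Q.degree < (b : WithBot ℕ)) :
    (P * Q).degree < ((a + b : ℕ) : WithBot ℕ) := by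
  by_cases h0 : P * Q = 0
  · rw [h0, degree_zero]; exact WithBot.bot_lt_coe _
  have hP0 : P ≠ 0 := left_ne_zero_of_mul h0
  have hQ0 : Q ≠ 0 := right_ne_zero_of_mul h0
  rw [degree_eq_natDegree hP0] at hP
  rw [degree_eq_natDegree hQ0] at hQ
  rw [degree_eq_natDegree h0, natDegree_mul hP0 hQ0]
  norm_cast at hP hQ ⊢
  omega

theorem exists_coeff_eq {F : Type*} [Field F] (n : ℕ) (c : ℕ → F) (hc : ∀ j, n ≤ j → c j = 0) :
    ∃ P : F[X], P.degree < (n : WithBot ℕ) ∧ P.coeff = c := by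
  have h : (∑ i ∈ Finset.range n, C (c i) * X ^ i).coeff = c := by
    funext j
    rw [finsetSum_coeff]
    simp only [coeff_C_mul_X_pow]
    rw [Finset.sum_ite_eq]
    split_ifs with hj
    · rfl
    · rw [hc j (by simpa using hj)]
  exact ⟨_, (degree_lt_iff_coeff_zero _ _).mpr fun j hj => by rw [h, hc j hj], h⟩

theorem exists_eq_add_X_pow_mul {F : Type*} [Field F] (n : ℕ) (H : F[X]) :
    ∃ H₀ H₁ : F[X], H₀.degree < (n : WithBot ℕ) ∧ H = H₀ + X ^ n * H₁ ∧
      ∀ i, H₁.coeff i = H.coeff (n + i) := by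
  have hd : (H %ₘ X ^ n).degree < (n : WithBot ℕ) := by
    simpa using degree_modByMonic_lt H (monic_X_pow (R := F) n)
  have he : H = H %ₘ X ^ n + X ^ n * (H /ₘ X ^ n) := (modByMonic_add_div H (X ^ n)).symm
  refine ⟨_, _, hd, he, fun i => ?_⟩
  conv_rhs => rw [he]
  rw [coeff_add, (degree_lt_iff_coeff_zero _ _).mp hd _ (Nat.le_add_right n i), zero_add,
    add_comm n i, coeff_X_pow_mul]

/-- Blocks of degree < 2w placed at distance w overlap only with their neighbours, so at most two of
them reach the exponent p. -/
theorem coeff_eval_X_pow {F : Type*} [Field F] {w : ℕ} (hw : 0 < w) (T : F[X][X])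
    (hT : ∀ i, (T.coeff i).degree < ((w + w : ℕ) : WithBot ℕ)) (p : ℕ) :
    (T.eval (X ^ w)).coeff p = (T.coeff (p / w)).coeff (p % w) +
      if p < w then 0 else (T.coeff (p / w - 1)).coeff (w + p % w) := by
  -- The range is enlarged beyond the degree of T so that it surely contains the index p / w.
  rw [eval_eq_sum_range' (n := T.natDegree + 1 + (p / w + 1))
    ((Nat.lt_succ_self _).trans_le (Nat.le_add_right _ _)), finsetSum_coeff]
  simp only [← pow_mul, coeff_mul_X_pow']
  have hr := Nat.mod_lt p hw
  have hp := Nat.div_add_mod p w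
  generalize p / w = q at *
  generalize p % w = r at *
  have hbig : ∀ i d, i < q → 2 * w ≤ d → (T.coeff i).coeff d = 0 := fun i d _ hd =>
    (degree_lt_iff_coeff_zero _ _).mp (hT i) d (by omega)
  rcases q with _ | q
  · rw [if_pos (by omega), add_zero, Finset.sum_eq_single 0]
    · rw [mul_zero, if_pos (Nat.zero_le _)]; congr 1; omega
    · intro i _ hi
      refine if_neg (not_le.mpr ?_)
      calc p < w * 1 := by omega
        _ ≤ w * i := Nat.mul_le_mul_left _ (by omega)
    · intro h; simp at h
  · have hle : w ≤ w * (q + 1) := Nat.le_mul_of_pos_right _ (by omega)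
    rw [if_neg (by omega), Finset.sum_eq_add (q + 1) q (by omega)]
    · rw [if_pos (by omega), if_pos (by rw [mul_add] at hp; omega)]
      congr 2
      · omega
      · rw [mul_add] at hp; omega
    · rintro i - ⟨h1, h2⟩
      split_ifs with hi
      · rcases Nat.lt_or_ge (q + 1) i with h | h
        · have : w * (q + 1 + 1) ≤ w * i := Nat.mul_le_mul_left _ h
          rw [mul_add w (q + 1)] at this
          omega
        · refine hbig _ _ (by omega) ?_
          have : w * (i + 2) ≤ w * (q + 1) := Nat.mul_le_mul_left _ (by omega)
          rw [mul_add w i] at this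
          omega
      · rfl
    · intro h; simp at h; omega
    · intro h; simp at h; omega

/-! ### Correctness of the bit algorithms -/

@[simp] theorem bitOps_add_val (x y : ZMod 2) : (bitOps.add x y).val = x + y := rfl

@[simp] theorem bitOps_mul_val (x y : ZMod 2) : (bitOps.mul x y).val = x * y := rfl

@[simp] theorem bitOps_const (x : ZMod 2) : bitOps.const x = x := rfl

@[simp] theorem bitOps_zero : bitOps.zero = 0 := rfl

theorem convSum_val (n : ℕ) (x y : ℕ → ZMod 2) (i s : ℕ) :
    (convSum bitOps n x y i s).val =
      ∑ j ∈ Finset.range s, if j ≤ i ∧ i - j < n then x j * y (i - j) else 0 := by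
  induction s with
  | zero => rfl
  | succ s ih =>
    rw [Finset.sum_range_succ, ← ih, convSum]
    split_ifs <;> simp

/-- `mulAlg` multiplies polynomials of degree `< n` over `GF(2)`. -/
def MultipliesBelow (n : ℕ) (mulAlg : (ℕ → ZMod 2) → (ℕ → ZMod 2) → Costed (ℕ → ZMod 2)) : Prop :=
  ∀ P Q : (ZMod 2)[X], P.degree < (n : WithBot ℕ) → Q.degree < (n : WithBot ℕ) →
    (mulAlg P.coeff Q.coeff).val = (P * Q).coeff

theorem schoolbook_multipliesBelow (n : ℕ) : MultipliesBelow n (schoolbook bitOps n) := by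
  intro P Q hP hQ
  funext i
  rw [schoolbook, val_tabulate_apply]
  have hPc := (degree_lt_iff_coeff_zero _ _).mp hP
  have hQc := (degree_lt_iff_coeff_zero _ _).mp hQ
  simp only [convSum_val, bitOps_zero]
  split_ifs with hi
  · rw [coeff_mul, Finset.Nat.sum_antidiagonal_eq_sum_range_succ_mk]
    -- The two summation ranges i + 1 and n are compared inside the common range n + i + 1.
    have h1 : ∑ j ∈ Finset.range i.succ, P.coeff j * Q.coeff (i - j) =
        ∑ j ∈ Finset.range (n + i.succ), if j ≤ i then P.coeff j * Q.coeff (i - j) else 0 := by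
      rw [← Finset.sum_subset (Finset.range_subset_range.mpr (Nat.le_add_left i.succ n))]
      · refine Finset.sum_congr rfl fun j hj => ?_
        rw [Finset.mem_range] at hj
        rw [if_pos (by omega)]
      · intro j _ hj
        rw [Finset.mem_range] at hj
        rw [if_neg (by omega)]
    simp only at h1 ⊢
    rw [h1, ← Finset.sum_subset (Finset.range_subset_range.mpr (Nat.le_add_right n i.succ))]
    · refine Finset.sum_congr rfl fun j _ => ?_
      by_cases hj : j ≤ i
      · by_cases hn : i - j < n
        · simp [hj, hn]
        · simp [hj, hn, hQc _ (not_lt.mp hn)]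
      · simp [hj]
    · intro j _ hj
      rw [hPc j (by simpa using hj), zero_mul, ite_self]
  · exact ((degree_lt_iff_coeff_zero _ _).mp (degree_mul_lt_add hP.le hQ) i (by omega)).symm

/-- The array `x` represents the field element `c`, in powers of `β_{2^L}`. -/
def FieldRep {L : ℕ} (β : CantorBasis L) (x : ℕ → ZMod 2) (c : GaloisField 2 (2 ^ L)) : Prop :=
  ∃ P : (ZMod 2)[X], P.degree < ((2 ^ L : ℕ) : WithBot ℕ) ∧ P.coeff = x ∧ aeval β.gen P = c

namespace CantorBasis

variable {L : ℕ} (β : CantorBasis L)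

theorem natDegree_modulusInv : β.modulusInv.natDegree = 2 ^ L := by
  rw [modulusInv, natDegree_divByMonic _ β.modulus_monic, natDegree_X_pow, natDegree_modulus]
  omega

theorem modulusInv_monic : β.modulusInv.Monic := by
  rw [Monic, modulusInv, leadingCoeff_divByMonic_of_monic β.modulus_monic]
  · exact monic_X_pow _
  · rw [degree_modulus, degree_X_pow]
    exact_mod_cast Nat.le_mul_of_pos_left _ two_pos

end CantorBasis

theorem exists_constArray_eq {n : ℕ} {P : (ZMod 2)[X]} (hP : P.Monic) (hn : P.natDegree = n) :
    ∃ P' : (ZMod 2)[X], P'.degree < (n : WithBot ℕ) ∧ P'.coeff = constArray bitOps n P ∧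
      P = X ^ n + P' := by
  obtain ⟨P', hd, hc⟩ := exists_coeff_eq n (constArray bitOps n P)
    (fun j hj => by simp [constArray, Nat.not_lt.mpr hj])
  refine ⟨P', hd, hc, ?_⟩
  ext j
  rw [coeff_add, hc, coeff_X_pow, constArray]
  rcases lt_trichotomy j n with h | h | h
  · simp [h, h.ne]
  · subst hn
    simp [h, hP]
  · rw [coeff_eq_zero_of_natDegree_lt (hn ▸ h)]
    simp [h.ne', h.not_gt]

/-- Division with remainder by a monic polynomial `μ` through a multiplication by the quotient `ν`
of `X ^ (2 * n)` by `μ`. -/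
theorem degree_sub_mul_lt_of_inv {F : Type*} [Field F] {n : ℕ} {μ ν ρ H₀ H₁ q E₀ : F[X]}
    (hμ : μ.degree ≤ (n : WithBot ℕ)) (hρ : ρ.degree < (n : WithBot ℕ))
    (hν : X ^ (2 * n) = μ * ν + ρ) (hH₀ : H₀.degree < (n : WithBot ℕ))
    (hH₁ : H₁.degree < (n : WithBot ℕ)) (hE₀ : E₀.degree < (n : WithBot ℕ))
    (hq : H₁ * ν = E₀ + X ^ n * q) :
    (H₀ + X ^ n * H₁ - q * μ).degree < (n : WithBot ℕ) := by
  -- After multiplication by X^n the remainder is a sum of three products of degree < 2n, so the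
  -- remainder itself has degree < n.
  have h : X ^ n * (H₀ + X ^ n * H₁ - q * μ) = X ^ n * H₀ + μ * E₀ + ρ * H₁ := by
    have : (X : F[X]) ^ n * X ^ n = μ * ν + ρ := by rw [← hν, two_mul, pow_add]
    linear_combination H₁ * this + μ * hq
  have hd : (X ^ n * (H₀ + X ^ n * H₁ - q * μ)).degree < ((n + n : ℕ) : WithBot ℕ) := by
    rw [h, ← mem_degreeLT]
    refine add_mem (add_mem ?_ ?_) ?_ <;> rw [mem_degreeLT]
    · exact degree_mul_lt_add (degree_X_pow_le n) hH₀
    · exact degree_mul_lt_add hμ hE₀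
    · exact degree_mul_lt_add hρ.le hH₁
  rw [degree_lt_iff_coeff_zero] at hd ⊢
  intro j hj
  have := hd (j + n) (by omega)
  rwa [coeff_X_pow_mul] at this

theorem fieldOps_represents {L : ℕ} (β : CantorBasis L)
    {polyMul : (ℕ → ZMod 2) → (ℕ → ZMod 2) → Costed (ℕ → ZMod 2)}
    (hpm : MultipliesBelow (2 ^ L) polyMul) :
    (fieldOps bitOps β polyMul).Represents (FieldRep β) where
  const c := by
    obtain ⟨hd, he⟩ := β.reprPoly_spec c
    refine ⟨_, hd, ?_, he⟩
    funext j
    change _ = constArray bitOps (2 ^ L) (β.reprPoly c) j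
    rw [constArray]
    split_ifs with hj
    · rfl
    · exact (degree_lt_iff_coeff_zero _ _).mp hd j (by omega)
  add := by
    rintro _ _ _ _ ⟨P, hP, rfl, rfl⟩ ⟨Q, hQ, rfl, rfl⟩
    refine ⟨P + Q, (degree_add_le P Q).trans_lt (max_lt hP hQ), ?_, map_add _ _ _⟩
    funext j
    change _ = (tabulate _ _ _).val j
    rw [val_tabulate_apply]
    split_ifs with hj
    · exact coeff_add _ _ _
    · rw [coeff_add, (degree_lt_iff_coeff_zero _ _).mp hP j (by omega),
        (degree_lt_iff_coeff_zero _ _).mp hQ j (by omega), add_zero]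
      rfl
  mul := by
    rintro _ _ _ _ ⟨P, hP, rfl, rfl⟩ ⟨Q, hQ, rfl, rfl⟩
    obtain ⟨μ', hμ'd, hμ'c, hμ⟩ := exists_constArray_eq β.modulus_monic β.natDegree_modulus
    obtain ⟨ν', hν'd, hν'c, hν⟩ := exists_constArray_eq β.modulusInv_monic β.natDegree_modulusInv
    obtain ⟨H₀, H₁, hH₀, hH, hH₁c⟩ := exists_eq_add_X_pow_mul (2 ^ L) (P * Q)
    obtain ⟨E₀, E₁, hE₀, hE, hE₁c⟩ := exists_eq_add_X_pow_mul (2 ^ L) (H₁ * ν')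
    have hhalf : ∀ {A B S : (ZMod 2)[X]}, A.degree < ((2 ^ L : ℕ) : WithBot ℕ) →
        B.degree < ((2 ^ L : ℕ) : WithBot ℕ) → (∀ i, S.coeff i = (A * B).coeff (2 ^ L + i)) →
        S.degree < ((2 ^ L : ℕ) : WithBot ℕ) := by
      intro A B S hA hB hS
      rw [degree_lt_iff_coeff_zero]
      intro j hj
      rw [hS]
      exact (degree_lt_iff_coeff_zero _ _).mp (degree_mul_lt_add hA.le hB) _ (by omega)
    have hH₁ := hhalf hP hQ hH₁c
    have hE₁ := hhalf hH₁ hν'd hE₁c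
    have hq : (H₁ + E₁).degree < ((2 ^ L : ℕ) : WithBot ℕ) :=
      (degree_add_le _ _).trans_lt (max_lt hH₁ hE₁)
    -- The quotient is H₁ + E₁ because H₁ ν = X^n H₁ + H₁ ν' = E₀ + X^n (H₁ + E₁).
    have hdeg := degree_sub_mul_lt_of_inv (q := H₁ + E₁) β.degree_modulus.le
      (ρ := X ^ (2 * 2 ^ L) %ₘ β.modulus) (ν := β.modulusInv)
      (by rw [← β.degree_modulus]; exact degree_modByMonic_lt _ β.modulus_monic)
      (by rw [add_comm]; exact (modByMonic_add_div _ _).symm)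
      hH₀ hH₁ hE₀ (by rw [hν, mul_add, hE]; ring)
    rw [← hH] at hdeg
    refine ⟨_, hdeg, ?_, ?_⟩
    · have e1 : (fun i => (P * Q).coeff (2 ^ L + i)) = H₁.coeff := funext fun i => (hH₁c i).symm
      have e2 : (tabulate bitOps.zero (2 ^ L) fun i =>
          bitOps.add ((P * Q).coeff (2 ^ L + i)) ((H₁ * ν').coeff (2 ^ L + i))).val =
          (H₁ + E₁).coeff := by
        funext i
        rw [val_tabulate_apply]
        split_ifs with hi
        · rw [coeff_add, hH₁c, hE₁c]; rfl
        · exact ((degree_lt_iff_coeff_zero _ _).mp hq i (by omega)).symm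
      funext j
      simp only [fieldOps, val_bind]
      rw [hpm P Q hP hQ, e1, ← hν'c, hpm H₁ ν' hH₁ hν'd, e2, ← hμ'c, hpm _ μ' hq hμ'd, val_tabulate_apply]
      split_ifs with hj
      -- Below the exponent n the leading term X^n of the modulus contributes nothing, so
      -- multiplying by μ' suffices.
      · rw [bitOps_add_val, coeff_sub, CharTwo.sub_eq_add]
        nth_rw 1 [hμ]
        rw [mul_add, coeff_add, coeff_mul_X_pow', if_neg (by omega), zero_add]
      · exact (degree_lt_iff_coeff_zero _ _).mp hdeg j (by omega)
    · rw [map_sub, map_mul, map_mul, β.aeval_modulus, mul_zero, sub_zero]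

/-- The polynomial in a new variable whose coefficients are the blocks of length `w` of `P`. -/
theorem exists_blocks {F : Type*} [Field F] {w M : ℕ} (hw : 0 < w) {P : F[X]}
    (hP : P.degree < ((w * M : ℕ) : WithBot ℕ)) :
    ∃ T : F[X][X], T.degree < (M : WithBot ℕ) ∧ (∀ i, (T.coeff i).degree < (w : WithBot ℕ)) ∧
      (∀ i, (T.coeff i).coeff = fun j => if j < w then P.coeff (w * i + j) else 0) ∧
      T.eval (X ^ w) = P := by
  choose A hAd hAc using fun i => exists_coeff_eq w
    (fun j => if j < w then P.coeff (w * i + j) else 0) (fun j hj => if_neg (by omega))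
  have hPc := (degree_lt_iff_coeff_zero _ _).mp hP
  have hA0 : ∀ i, M ≤ i → A i = 0 := by
    intro i hi
    ext j
    rw [hAc]
    have := Nat.mul_le_mul_left w hi
    simp [hPc (w * i + j) (by omega)]
  let T : F[X][X] := ∑ i ∈ Finset.range M, C (A i) * X ^ i
  have hT : ∀ i, T.coeff i = A i := by
    intro i
    simp only [T, finsetSum_coeff, coeff_C_mul_X_pow]
    rw [Finset.sum_ite_eq]
    split_ifs with hi
    · rfl
    · exact (hA0 i (by simpa using hi)).symm
  refine ⟨T, (degree_lt_iff_coeff_zero _ _).mpr fun i hi => by rw [hT, hA0 i hi],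
    fun i => hT i ▸ hAd i, fun i => hT i ▸ hAc i, ?_⟩
  ext p
  rw [coeff_eval_X_pow hw T (fun i => hT i ▸ (hAd i).trans_le (by exact_mod_cast Nat.le_add_left _ _)),
    hT, hT, hAc, hAc]
  have hr := Nat.mod_lt p hw
  simp [hr, Nat.div_add_mod]

/-- One level of the special multiplication algorithm, for `n = 2 ^ L` and a given algorithm for the
multiplication of polynomials of degree `< n`. -/
noncomputable def SMAStep {B : Type} (o : Ops (ZMod 2) B) {L : ℕ} (β : CantorBasis L) (m : ℕ)
    (polyMul : (ℕ → B) → (ℕ → B) → Costed (ℕ → B)) (f g : ℕ → B) : Costed (ℕ → B) :=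
  MA (fieldOps o β polyMul) β.elt (m - L + 1)
    (fun i j => if j < 2 ^ (L - 1) then f (2 ^ (L - 1) * i + j) else o.zero)
    (fun i j => if j < 2 ^ (L - 1) then g (2 ^ (L - 1) * i + j) else o.zero) >>= fun H =>
  tabulate o.zero (2 ^ (m + 1)) fun p =>
    if p < 2 ^ (L - 1) then pure (H 0 p)
    else o.add (H (p / 2 ^ (L - 1)) (p % 2 ^ (L - 1)))
      (H (p / 2 ^ (L - 1) - 1) (2 ^ (L - 1) + p % 2 ^ (L - 1)))

theorem SMA_eq_SMAStep {B : Type} (o : Ops (ZMod 2) B) (β : ∀ L, CantorBasis L) {m : ℕ}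
    (hm : m ≠ 0) (f g : ℕ → B) :
    SMA o β m f g = SMAStep o (β (Nat.clog 2 (m + 1))) m
      (if Nat.clog 2 (m + 1) < m then SMA o β (Nat.clog 2 (m + 1))
        else schoolbook o (2 ^ Nat.clog 2 (m + 1))) f g := by
  rw [SMA, if_neg hm]
  split_ifs <;> rfl

/-- P and Q are the values at X^w of bivariate polynomials S and T, so P * Q is that of S * T. The
algorithm computes S * T with the inner variable replaced by β, and this loses nothing, since the
coefficients of S * T have degree < 2w = 2^L. -/
theorem SMAStep_multipliesBelow {L m : ℕ} (β : CantorBasis L) (hL1 : 1 ≤ L) (hLm : L ≤ m)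
    (hmL : m + 1 ≤ 2 ^ L) {polyMul : (ℕ → ZMod 2) → (ℕ → ZMod 2) → Costed (ℕ → ZMod 2)}
    (hpoly : MultipliesBelow (2 ^ L) polyMul) :
    MultipliesBelow (2 ^ m) (SMAStep bitOps β m polyMul) := by
  intro P Q hP hQ
  have hrep := fieldOps_represents β hpoly
  simp only [SMAStep, val_bind]
  set w := 2 ^ (L - 1) with hw
  have hw0 : 0 < w := Nat.two_pow_pos _
  have hww : w + w = 2 ^ L := by
    rw [← two_mul, hw, ← pow_succ', Nat.sub_add_cancel hL1]
  have hwM : w * 2 ^ (m - L + 1) = 2 ^ m := by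
    rw [hw, ← pow_add]; congr 1; omega
  obtain ⟨S, hSd, hSb, hSc, hSe⟩ := exists_blocks hw0 (hwM ▸ hP)
  obtain ⟨T, hTd, hTb, hTc, hTe⟩ := exists_blocks hw0 (hwM ▸ hQ)
  have hwL : (w : WithBot ℕ) ≤ ((2 ^ L : ℕ) : WithBot ℕ) := by
    exact_mod_cast hww ▸ Nat.le_add_left w w
  let φ : (ZMod 2)[X] →+* GaloisField 2 (2 ^ L) := (aeval β.gen).toRingHom
  have hSTb : ∀ i, ((S * T).coeff i).degree < ((w + w : ℕ) : WithBot ℕ) := by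
    intro i
    rw [coeff_mul, ← mem_degreeLT]
    refine sum_mem fun x _ => ?_
    rw [mem_degreeLT]
    exact degree_mul_lt_add (hSb _).le (hTb _)
  have hMA : ∀ i < 2 ^ (m - L + 1 + 1),
      (MA (fieldOps bitOps β polyMul) β.elt (m - L + 1)
        (fun i j => if j < w then P.coeff (w * i + j) else bitOps.zero)
        (fun i j => if j < w then Q.coeff (w * i + j) else bitOps.zero)).val i =
      ((S * T).coeff i).coeff := by
    intro i hi
    obtain ⟨U, hUd, hUc, hUe⟩ := MA_represents hrep β.elt (m - L + 1)
      (f' := (S.map φ).coeff) (g' := (T.map φ).coeff)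
      (fun i => ⟨S.coeff i, (hSb i).trans_le hwL, hSc i, (coeff_map φ i).symm⟩)
      (fun i => ⟨T.coeff i, (hTb i).trans_le hwL, hTc i, (coeff_map φ i).symm⟩) i
    rw [MA_val β _ (by omega) (degree_map_le.trans_lt hSd) (degree_map_le.trans_lt hTd)
      i hi, ← Polynomial.map_mul, coeff_map] at hUe
    rw [β.eq_of_aeval_gen_eq hUd (hww ▸ hSTb i) hUe] at hUc
    exact hUc.symm
  generalize (MA (fieldOps bitOps β polyMul) β.elt (m - L + 1) _ _).val = H at hMA ⊢
  funext p
  rw [val_tabulate_apply]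
  split_ifs with hp hpw'
  · rw [← hSe, ← hTe, ← eval_mul, coeff_eval_X_pow hw0 _ hSTb, val_pure,
      hMA 0 (Nat.two_pow_pos _), Nat.div_eq_of_lt hpw', Nat.mod_eq_of_lt hpw', if_pos hpw', add_zero]
  · have hpw : p / w < 2 ^ (m - L + 1 + 1) := by
      apply Nat.div_lt_of_lt_mul
      rwa [pow_succ, ← mul_assoc, hwM]
    rw [← hSe, ← hTe, ← eval_mul, coeff_eval_X_pow hw0 _ hSTb, bitOps_add_val, hMA _ hpw,
      hMA _ ((Nat.sub_le _ _).trans_lt hpw), if_neg hpw']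
  · refine ((degree_lt_iff_coeff_zero _ _).mp (degree_mul_lt_add hP.le hQ) p ?_).symm
    rw [pow_succ] at hp
    omega

/-- With L = ⌈log₂(m+1)⌉, the first three bounds make the blocks proper, their number 2^(m-L+1)
meaningful and the field large enough; the last one drives the induction on the cost. -/
theorem clog_succ_bounds {m : ℕ} (hm : m ≠ 0) :
    1 ≤ Nat.clog 2 (m + 1) ∧ Nat.clog 2 (m + 1) ≤ m ∧ m + 1 ≤ 2 ^ Nat.clog 2 (m + 1) ∧
      2 ^ (Nat.clog 2 (m + 1) - 1) ≤ m :=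
  ⟨Nat.clog_pos one_lt_two (by omega), Nat.clog_le_of_le_pow Nat.lt_two_pow_self,
    Nat.le_pow_clog one_lt_two _,
    Nat.lt_succ_iff.mp (Nat.pow_pred_clog_lt_self one_lt_two (by omega))⟩

theorem SMA_multipliesBelow (β : ∀ L, CantorBasis L) (m : ℕ) :
    MultipliesBelow (2 ^ m) (SMA bitOps β m) := by
  induction m using Nat.strong_induction_on with
  | _ m ih =>
    intro P Q hP hQ
    by_cases hm : m = 0
    · rw [SMA, if_pos hm]
      subst hm
      funext i
      simp only [val_bind, val_pure, bitOps_mul_val, bitOps_zero]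
      split_ifs with hi
      · rw [hi, mul_coeff_zero]
      · have hP' : P.degree ≤ ((0 : ℕ) : WithBot ℕ) := by
          rw [degree_le_iff_coeff_zero]
          exact fun j hj => (degree_lt_iff_coeff_zero P 1).mp hP j (by exact_mod_cast hj)
        exact ((degree_lt_iff_coeff_zero _ _).mp (degree_mul_lt_add hP' hQ) i (by omega)).symm
    · obtain ⟨h1, h2, h3, -⟩ := clog_succ_bounds hm
      rw [SMA_eq_SMAStep _ _ hm]
      refine SMAStep_multipliesBelow _ h1 h2 h3 ?_ P Q hP hQ
      split_ifs with h
      · exact ih _ h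
      · exact schoolbook_multipliesBelow _

/-! ### Costs -/

theorem cost_tabulate_le {α : Type} (d : α) (n : ℕ) (g : ℕ → Costed α) {c : ℕ}
    (h : ∀ i < n, (g i).cost ≤ c) : (tabulate d n g).cost ≤ n * c := by
  rw [cost_tabulate]
  simpa using Finset.sum_le_card_nsmul (Finset.range n) (fun i => (g i).cost) c
    (fun i hi => h i (Finset.mem_range.mp hi))

/-- An addition costs at most `ca` and a multiplication at most `cm`. -/
structure Ops.CostBound {K X : Type} (O : Ops K X) (ca cm : ℕ) : Prop where
  add : ∀ x y, (O.add x y).cost ≤ ca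
  mul : ∀ x y, (O.mul x y).cost ≤ cm

section FieldCost

variable {K X : Type} {O : Ops K X} {ca cm : ℕ}

theorem sqIter_cost_le (h : O.CostBound ca cm) (k : ℕ) (x : X) :
    (sqIter O k x).cost ≤ k * cm := by
  induction k generalizing x with
  | zero => simp [sqIter]
  | succ k ih =>
    simp only [sqIter, cost_bind]
    have := h.mul x x
    have := ih (O.mul x x).val
    linarith

variable [Field K]

theorem pred_two_pow_mul_le (k r : ℕ) : (2 ^ k - 1) * 2 ^ r ≤ 2 ^ k * 2 ^ r :=
  Nat.mul_le_mul_right _ (Nat.sub_le _ _)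

theorem gaoMateer_cost_le (h : O.CostBound ca cm) (k r : ℕ) (f : ℕ → X) :
    (gaoMateer O k r f).cost ≤ r * (2 ^ k * 2 ^ r * ca) := by
  induction r generalizing f with
  | zero => simp [gaoMateer]
  | succ r ih =>
    simp only [gaoMateer, cost_bind, cost_pure]
    have h1 := cost_tabulate_le O.zero ((2 ^ k - 1) * 2 ^ r) (c := ca) (fun i =>
      if i < 2 ^ r then O.add (f (2 ^ k * 2 ^ r + i)) (f ((2 * 2 ^ k - 1) * 2 ^ r + i))
      else pure (f (2 ^ k * 2 ^ r + i))) (fun i _ => by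
        split_ifs
        · exact h.add _ _
        · exact Nat.zero_le _)
    generalize (tabulate O.zero ((2 ^ k - 1) * 2 ^ r) fun i =>
      if i < 2 ^ r then O.add (f (2 ^ k * 2 ^ r + i)) (f ((2 * 2 ^ k - 1) * 2 ^ r + i))
      else pure (f (2 ^ k * 2 ^ r + i))) = H at h1 ⊢
    have h2 := cost_tabulate_le O.zero (2 ^ k * 2 ^ r) (c := ca) (fun i =>
      if i < 2 ^ r then pure (f i) else O.add (f i) (H.val (i - 2 ^ r))) (fun i _ => by
        split_ifs
        · exact Nat.zero_le _
        · exact h.add _ _)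
    generalize (tabulate O.zero (2 ^ k * 2 ^ r) fun i =>
      if i < 2 ^ r then pure (f i) else O.add (f i) (H.val (i - 2 ^ r))) = G at h2 ⊢
    have h3 := ih G.val
    have h4 := ih fun i => if i < (2 ^ k - 1) * 2 ^ r then H.val i else f (2 ^ k * 2 ^ r + i)
    have h5 := Nat.mul_le_mul_right ca (pred_two_pow_mul_le k r)
    rw [pow_succ]
    linarith

theorem gaoMateerInv_cost_le (h : O.CostBound ca cm) (k r : ℕ) (f : ℕ → ℕ → X) :
    (gaoMateerInv O k r f).cost ≤ r * (2 ^ k * 2 ^ r * ca) := by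
  induction r generalizing f with
  | zero => simp [gaoMateerInv]
  | succ r ih =>
    simp only [gaoMateerInv, cost_bind, cost_pure]
    have h1 := ih f
    have h2 := ih fun j => f (j + 2 ^ r)
    generalize gaoMateerInv O k r f = G at h1 ⊢
    generalize (gaoMateerInv O k r fun j => f (j + 2 ^ r)) = H at h2 ⊢
    have h3 := cost_tabulate_le O.zero (2 ^ k * 2 ^ r) (c := ca) (fun i =>
      if i < 2 ^ r then pure (G.val i) else O.add (G.val i) (H.val (i - 2 ^ r))) (fun i _ => by
        split_ifs
        · exact Nat.zero_le _
        · exact h.add _ _)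
    have h4 := cost_tabulate_le O.zero (2 ^ k * 2 ^ r) (c := ca) (fun i =>
      if i < 2 ^ r then O.add (H.val i) (H.val (i + (2 ^ k - 1) * 2 ^ r)) else pure (H.val i))
      (fun i _ => by
        split_ifs
        · exact h.add _ _
        · exact Nat.zero_le _)
    rw [pow_succ]
    linarith

/-- A bound for the cost of evaluation and interpolation at `2 ^ m` points. -/
def evalBound (ca cm m : ℕ) : ℕ := 2 ^ m * (2 * m * (Nat.clog 2 m + 1) * ca + 2 * m * cm)

/-- The two families of recursive calls each leave a slack (ca + cm) 2^m. One pays for the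
squarings, for b and for the shifted points; the other is passed on. The Gao–Mateer expansion is
paid for by ⌈log₂⌉ dropping by at least one in both recursive calls. -/
theorem evalBound_step (ca cm : ℕ) {m : ℕ} (hm : ¬ m ≤ 1) {c₁ c₂ : ℕ}
    (h₁ : c₁ + (ca + cm) * 2 ^ (m - splitPoint m) ≤ evalBound ca cm (m - splitPoint m))
    (h₂ : c₂ + (ca + cm) * 2 ^ splitPoint m ≤ evalBound ca cm (splitPoint m)) :
    splitPoint m * cm + ca + (m - splitPoint m) * (2 ^ splitPoint m * 2 ^ (m - splitPoint m) * ca) +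
      2 ^ splitPoint m * c₁ + 2 ^ (m - splitPoint m) * (ca + c₂) + (ca + cm) * 2 ^ m ≤
      evalBound ca cm m := by
  have hl : 1 ≤ Nat.clog 2 m := Nat.clog_pos one_lt_two (by omega)
  have hlt := splitPoint_lt hm
  have hk1 : 1 ≤ splitPoint m := Nat.one_le_two_pow
  have hkl : Nat.clog 2 (splitPoint m) = Nat.clog 2 m - 1 := Nat.clog_pow 2 _ one_lt_two
  have hjl : Nat.clog 2 (m - splitPoint m) ≤ Nat.clog 2 m - 1 := by
    refine Nat.clog_le_of_le_pow ?_
    have h2 : m ≤ 2 ^ Nat.clog 2 m := Nat.le_pow_clog one_lt_two m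
    rw [← Nat.sub_add_cancel hl, pow_succ] at h2
    change m - 2 ^ (Nat.clog 2 m - 1) ≤ _
    omega
  unfold evalBound at *
  rw [hkl] at h₂
  generalize splitPoint m = k at *
  generalize Nat.clog 2 m = l at *
  obtain ⟨l, rfl⟩ := Nat.exists_eq_add_of_le' hl
  obtain ⟨j, rfl⟩ := Nat.exists_eq_add_of_le hlt.le
  simp only [Nat.add_sub_cancel_left, Nat.add_sub_cancel] at *
  have hj : 1 ≤ j := by omega
  have hka : k < 2 ^ k := Nat.lt_two_pow_self
  have ha : 2 ≤ 2 ^ k := by omega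
  have hb : j < 2 ^ j := Nat.lt_two_pow_self
  rw [pow_add]
  generalize 2 ^ k = a at *
  generalize 2 ^ j = b at *
  have hjl' : b * (2 * j * (Nat.clog 2 j + 1) * ca + 2 * j * cm) ≤
      b * (2 * j * (l + 1) * ca + 2 * j * cm) := by gcongr
  have i1 := Nat.mul_le_mul_left a (h₁.trans hjl')
  have i2 := Nat.mul_le_mul_left b h₂
  have i3 : k * cm ≤ a * b * cm := Nat.mul_le_mul_right _ (by nlinarith)
  have i4 : (1 + b) * ca ≤ a * b * ca := Nat.mul_le_mul_right _ (by nlinarith)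
  have i5 : 0 ≤ k * (a * b * ca) := Nat.zero_le _
  have i6 : 0 ≤ j * (a * b * ca) := Nat.zero_le _
  nlinarith

/-- The term (ca + cm) 2^m strengthens the claim for the induction; it absorbs the overhead outside
the recursive calls and the expansion. -/
theorem EA_cost_le (h : O.CostBound ca cm) (ϖ : ℕ → K) (m : ℕ) (hm0 : 1 ≤ m) (f : ℕ → X) (a : X) :
    (EA O ϖ m f a).cost + (ca + cm) * 2 ^ m ≤ evalBound ca cm m := by
  induction m using Nat.strong_induction_on generalizing f a with
  | _ m ih =>
    rw [EA]
    split_ifs with hm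
    · obtain rfl : m = 1 := by omega
      simp only [cost_bind, cost_pure, evalBound, Nat.clog_one_right]
      have h1 := h.mul (f 1) a
      have h2 := h.add (f 0) (O.mul (f 1) a).val
      have h3 := h.add (O.add (f 0) (O.mul (f 1) a).val).val (f 1)
      linarith
    · have hlt := splitPoint_lt hm
      have hk1 : 1 ≤ splitPoint m := Nat.one_le_two_pow
      have bound : ∀ k, k < m → 1 ≤ k →
          ∃ c, (∀ f a, (EA O ϖ k f a).cost ≤ c) ∧ c + (ca + cm) * 2 ^ k ≤ evalBound ca cm k :=
        fun k hk hk1 => ⟨evalBound ca cm k - (ca + cm) * 2 ^ k,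
          fun f a => by have := ih k hk hk1 f a; omega,
          by have := ih k hk hk1 f a; omega⟩
      obtain ⟨c₁, hc₁, hb₁⟩ := bound (m - splitPoint m) (by omega) (by omega)
      obtain ⟨c₂, hc₂, hb₂⟩ := bound (splitPoint m) hlt hk1
      refine le_trans ?_ (evalBound_step ca cm hm hb₁ hb₂)
      simp only [cost_bind, cost_pure, val_bind, val_pure, RA]
      have h1 := sqIter_cost_le h (splitPoint m) a
      have h2 := h.add (sqIter O (splitPoint m) a).val a
      generalize (O.add (sqIter O (splitPoint m) a).val a) = b at h2 ⊢
      have h3 := gaoMateer_cost_le h (splitPoint m) (m - splitPoint m) f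
      generalize (gaoMateer O (splitPoint m) (m - splitPoint m) f) = G at h3 ⊢
      have h4 := cost_tabulate_le (fun _ => O.zero) (2 ^ splitPoint m)
        (fun i => EA O ϖ (m - splitPoint m) (fun j => G.val j i) b.val) (fun i _ => hc₁ _ _)
      generalize (tabulate (fun _ => O.zero) (2 ^ splitPoint m)
        (fun i => EA O ϖ (m - splitPoint m) (fun j => G.val j i) b.val)) = R at h4 ⊢
      have h5 := cost_tabulate_le (fun _ => O.zero) (2 ^ (m - splitPoint m))
        (fun j => O.add a (O.const (ϖ (j * 2 ^ splitPoint m))) >>= fun a_j =>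
          EA O ϖ (splitPoint m) (fun i => R.val i j) a_j)
        (fun i _ => Nat.add_le_add (h.add _ _) (hc₂ _ _))
      linarith

theorem IA_cost_le (h : O.CostBound ca cm) (ϖ : ℕ → K) (m : ℕ) (hm0 : 1 ≤ m) (v : ℕ → X) (a : X) :
    (IA O ϖ m v a).cost + (ca + cm) * 2 ^ m ≤ evalBound ca cm m := by
  induction m using Nat.strong_induction_on generalizing v a with
  | _ m ih =>
    rw [IA]
    split_ifs with hm
    · obtain rfl : m = 1 := by omega
      simp only [cost_bind, cost_pure, evalBound, Nat.clog_one_right]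
      have h1 := h.add (v 0) (v 1)
      have h2 := h.mul a (O.add (v 0) (v 1)).val
      have h3 := h.add (v 0) (O.mul a (O.add (v 0) (v 1)).val).val
      linarith
    · have hlt := splitPoint_lt hm
      have hk1 : 1 ≤ splitPoint m := Nat.one_le_two_pow
      have bound : ∀ k, k < m → 1 ≤ k →
          ∃ c, (∀ v a, (IA O ϖ k v a).cost ≤ c) ∧ c + (ca + cm) * 2 ^ k ≤ evalBound ca cm k :=
        fun k hk hk1 => ⟨evalBound ca cm k - (ca + cm) * 2 ^ k,
          fun v a => by have := ih k hk hk1 v a; omega,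
          by have := ih k hk hk1 v a; omega⟩
      obtain ⟨c₁, hc₁, hb₁⟩ := bound (m - splitPoint m) (by omega) (by omega)
      obtain ⟨c₂, hc₂, hb₂⟩ := bound (splitPoint m) hlt hk1
      refine le_trans ?_ (evalBound_step ca cm hm hb₁ hb₂)
      simp only [cost_bind, DRA]
      have h1 := sqIter_cost_le h (splitPoint m) a
      have h2 := h.add (sqIter O (splitPoint m) a).val a
      generalize (O.add (sqIter O (splitPoint m) a).val a) = b at h2 ⊢
      have h5 := cost_tabulate_le (fun _ => O.zero) (2 ^ (m - splitPoint m))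
        (fun j => O.add a (O.const (ϖ (j * 2 ^ splitPoint m))) >>= fun a_j =>
          IA O ϖ (splitPoint m) (fun i => v (i + j * 2 ^ splitPoint m)) a_j)
        (fun i _ => Nat.add_le_add (h.add _ _) (hc₂ _ _))
      generalize (tabulate (fun _ => O.zero) (2 ^ (m - splitPoint m))
        (fun j => O.add a (O.const (ϖ (j * 2 ^ splitPoint m))) >>= fun a_j =>
          IA O ϖ (splitPoint m) (fun i => v (i + j * 2 ^ splitPoint m)) a_j)) = R at h5 ⊢
      have h4 := cost_tabulate_le (fun _ => O.zero) (2 ^ splitPoint m)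
        (fun i => IA O ϖ (m - splitPoint m) (fun j => R.val j i) b.val) (fun i _ => hc₁ _ _)
      generalize (tabulate (fun _ => O.zero) (2 ^ splitPoint m)
        (fun i => IA O ϖ (m - splitPoint m) (fun j => R.val j i) b.val)) = T at h4 ⊢
      have h3 := gaoMateerInv_cost_le h (splitPoint m) (m - splitPoint m) fun j i => T.val i j
      linarith

theorem MA_cost_le (h : O.CostBound ca cm) (ϖ : ℕ → K) (m : ℕ) (f g : ℕ → X) :
    (MA O ϖ m f g).cost ≤ 3 * evalBound ca cm (m + 1) + 2 ^ (m + 1) * cm := by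
  simp only [MA, cost_bind]
  have h1 := EA_cost_le h ϖ (m + 1) (by omega) f O.zero
  have h2 := EA_cost_le h ϖ (m + 1) (by omega) g O.zero
  generalize EA O ϖ (m + 1) f O.zero = u at h1 ⊢
  generalize EA O ϖ (m + 1) g O.zero = v at h2 ⊢
  have h3 := cost_tabulate_le O.zero (2 ^ (m + 1)) (fun i => O.mul (u.val i) (v.val i))
    (fun i _ => h.mul _ _)
  generalize (tabulate O.zero (2 ^ (m + 1)) fun i => O.mul (u.val i) (v.val i)) = w at h3 ⊢
  have h4 := IA_cost_le h ϖ (m + 1) (by omega) w.val O.zero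
  omega

end FieldCost

/-! ### Bit cost of one level of the recursion -/

theorem bitOps_costBound : bitOps.CostBound 1 1 := ⟨fun _ _ => le_rfl, fun _ _ => le_rfl⟩

theorem schoolbook_cost_le (n : ℕ) (x y : ℕ → ZMod 2) :
    (schoolbook bitOps n x y).cost ≤ 2 * n * (2 * n) := by
  refine cost_tabulate_le _ _ _ fun i _ => ?_
  have : ∀ s, (convSum bitOps n x y i s).cost ≤ 2 * s := by
    intro s
    induction s with
    | zero => simp [convSum]
    | succ s ih =>
      rw [convSum, cost_bind]
      split_ifs
      · change _ + (1 + 1) ≤ _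
        omega
      · change _ + 0 ≤ _
        omega
  exact this n

theorem fieldOps_costBound {L : ℕ} (β : CantorBasis L)
    {polyMul : (ℕ → ZMod 2) → (ℕ → ZMod 2) → Costed (ℕ → ZMod 2)} {p : ℕ}
    (hp : ∀ x y, (polyMul x y).cost ≤ p) :
    (fieldOps bitOps β polyMul).CostBound (2 ^ L) (3 * p + 2 * 2 ^ L) where
  add x y := (cost_tabulate_le _ _ _ fun _ _ => bitOps_costBound.add _ _).trans (mul_one _).le
  mul x y := by
    simp only [fieldOps, cost_bind]
    have ht : ∀ g : ℕ → ZMod 2 × ZMod 2,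
        (tabulate bitOps.zero (2 ^ L) fun i => bitOps.add (g i).1 (g i).2).cost ≤ 2 ^ L :=
      fun g => (cost_tabulate_le _ _ _ fun _ _ => bitOps_costBound.add _ _).trans (mul_one _).le
    have h1 := hp x y
    generalize polyMul x y = h at h1 ⊢
    have h2 := hp (fun i => h.val (2 ^ L + i)) (constArray bitOps (2 ^ L) β.modulusInv)
    generalize polyMul (fun i => h.val (2 ^ L + i)) (constArray bitOps (2 ^ L) β.modulusInv) = e
      at h2 ⊢
    have h3 := ht fun i => (h.val (2 ^ L + i), e.val (2 ^ L + i))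
    simp only at h3
    generalize (tabulate bitOps.zero (2 ^ L) fun i =>
      bitOps.add (h.val (2 ^ L + i)) (e.val (2 ^ L + i))) = q at h3 ⊢
    have h4 := hp q.val (constArray bitOps (2 ^ L) β.modulus)
    generalize polyMul q.val (constArray bitOps (2 ^ L) β.modulus) = d at h4 ⊢
    have h5 := ht fun i => (h.val i, d.val i)
    simp only at h5
    omega

/-- Packing preserves size: 2^M 2^L = 4 * 2^m for the transform length 2^M, M = m - L + 2. As ⌈log₂
M⌉ ≤ L and M ≤ 2m, the transforms spend O(2^m m L) bits on additions and O(2^m m (t + 1)) on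
multiplications. -/
theorem SMAStep_cost_le {L m : ℕ} (β : CantorBasis L) (hL1 : 1 ≤ L) (hLm : L ≤ m)
    (hmL : m + 1 ≤ 2 ^ L) {polyMul : (ℕ → ZMod 2) → (ℕ → ZMod 2) → Costed (ℕ → ZMod 2)} {p : ℕ}
    (hp : ∀ x y, (polyMul x y).cost ≤ p) {t : ℝ} (hpt : (p : ℝ) ≤ 2 ^ L * t) (f g : ℕ → ZMod 2) :
    ((SMAStep bitOps β m polyMul f g).cost : ℝ) ≤ 2 ^ m * (202 * m * (L + t)) := by
  have hcost : (SMAStep bitOps β m polyMul f g).cost ≤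
      3 * evalBound (2 ^ L) (3 * p + 2 * 2 ^ L) (m - L + 1 + 1) +
        2 ^ (m - L + 1 + 1) * (3 * p + 2 * 2 ^ L) + 2 ^ (m + 1) := by
    rw [SMAStep, cost_bind]
    refine Nat.add_le_add (MA_cost_le (fieldOps_costBound β hp) _ _ _ _) ?_
    refine (cost_tabulate_le _ _ _ (c := 1) fun i _ => ?_).trans (mul_one _).le
    split_ifs
    · exact Nat.zero_le _
    · exact bitOps_costBound.add _ _
  have hclog : Nat.clog 2 (m - L + 1 + 1) ≤ L := Nat.clog_le_of_le_pow (by omega)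
  have hM : m - L + 1 + 1 ≤ 2 * m := by omega
  have hpow : 2 ^ (m - L + 1 + 1) * 2 ^ L = 4 * 2 ^ m := by
    rw [show 4 = 2 ^ 2 by rfl, ← pow_add, ← pow_add]; congr 1; omega
  generalize m - L + 1 + 1 = M at *
  have hcost' : (SMAStep bitOps β m polyMul f g).cost ≤
      3 * (2 ^ M * (2 * (2 * m) * (L + 1) * 2 ^ L + 2 * (2 * m) * (3 * p + 2 * 2 ^ L))) +
        2 ^ M * (3 * p + 2 * 2 ^ L) + 2 ^ (m + 1) := by
    refine hcost.trans ?_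
    unfold evalBound
    gcongr
  have hR : ((SMAStep bitOps β m polyMul f g).cost : ℝ) ≤
      3 * (2 ^ M * (2 * (2 * m) * (L + 1) * 2 ^ L + 2 * (2 * m) * (3 * p + 2 * 2 ^ L))) +
        2 ^ M * (3 * p + 2 * 2 ^ L) + 2 ^ (m + 1) := by exact_mod_cast hcost'
  have hpowR : (2 : ℝ) ^ M * 2 ^ L = 4 * 2 ^ m := by exact_mod_cast hpow
  have hpM : (2 : ℝ) ^ M * p ≤ 4 * 2 ^ m * t := by
    rw [← hpowR, mul_assoc]
    exact mul_le_mul_of_nonneg_left hpt (by positivity)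
  have hm1 : (1 : ℝ) ≤ m := by exact_mod_cast hL1.trans hLm
  have hL1' : (1 : ℝ) ≤ L := by exact_mod_cast hL1
  have ht : 0 ≤ t := by
    have : (0 : ℝ) ≤ 2 ^ L * t := (Nat.cast_nonneg p).trans hpt
    exact nonneg_of_mul_nonneg_right this (by positivity)
  have e : 3 * ((2 : ℝ) ^ M * (2 * (2 * m) * (L + 1) * 2 ^ L +
        2 * (2 * m) * (3 * p + 2 * 2 ^ L))) + 2 ^ M * (3 * p + 2 * 2 ^ L) + 2 ^ (m + 1) =
      12 * m * (L + 1) * (2 ^ M * 2 ^ L) + (12 * m + 1) * (3 * (2 ^ M * p) + 2 * (2 ^ M * 2 ^ L)) +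
        2 * 2 ^ m := by ring
  have e2 : (12 * (m : ℝ) + 1) * (3 * (2 ^ M * p) + 2 * (2 ^ M * 2 ^ L)) ≤
      13 * m * (3 * (4 * 2 ^ m * t) + 2 * (4 * 2 ^ m)) := by
    rw [hpowR]
    gcongr
    linarith
  rw [e] at hR
  refine hR.trans ?_
  have e3 : 12 * (m : ℝ) * (L + 1) * (2 ^ M * 2 ^ L) +
      13 * m * (3 * (4 * 2 ^ m * t) + 2 * (4 * 2 ^ m)) + 2 * 2 ^ m =
      2 ^ m * (48 * m * (L + 1) + 156 * m * t + 104 * m + 2) := by rw [hpowR]; ring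
  -- By m, L ≥ 1 everything free of t is at most (48 + 48 + 104 + 2) m L = 202 m L, and 156 ≤ 202.
  have e4 : 48 * (m : ℝ) * (L + 1) + 156 * m * t + 104 * m + 2 ≤ 202 * m * (L + t) := by
    have h1 : (m : ℝ) * 1 ≤ m * L := by gcongr
    have h2 : 0 ≤ (m : ℝ) * t := by positivity
    nlinarith
  calc _ ≤ 12 * (m : ℝ) * (L + 1) * (2 ^ M * 2 ^ L) +
      13 * m * (3 * (4 * 2 ^ m * t) + 2 * (4 * 2 ^ m)) + 2 * 2 ^ m := by linarith
    _ = _ := e3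
    _ ≤ _ := mul_le_mul_of_nonneg_left e4 (by positivity)

/-! ### Solving the recurrence for the bit cost -/

/-- Supplies the finitely many base cases of the induction below; the bound must not depend on the
Cantor bases or on the inputs. -/
theorem SMA_cost_bddAbove (m : ℕ) : ∃ p : ℕ, ∀ (β : ∀ L, CantorBasis L) (f g : ℕ → ZMod 2),
    (SMA bitOps β m f g).cost ≤ p := by
  induction m using Nat.strong_induction_on with
  | _ m ih =>
    by_cases hm : m = 0
    · refine ⟨1, fun β f g => ?_⟩
      rw [SMA, if_pos hm]
      exact le_rfl
    · obtain ⟨h1, h2, h3, -⟩ := clog_succ_bounds hm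
      have hp : ∃ p : ℕ, ∀ (β : ∀ L, CantorBasis L) (x y : ℕ → ZMod 2),
          ((if Nat.clog 2 (m + 1) < m then SMA bitOps β (Nat.clog 2 (m + 1))
            else schoolbook bitOps (2 ^ Nat.clog 2 (m + 1))) x y).cost ≤ p := by
        split_ifs with h
        · exact ih _ h
        · exact ⟨_, fun _ => schoolbook_cost_le _⟩
      obtain ⟨p, hp⟩ := hp
      refine ⟨⌈(2 : ℝ) ^ m * (202 * m * (Nat.clog 2 (m + 1) + p))⌉₊, fun β f g => ?_⟩
      rw [SMA_eq_SMAStep _ _ hm]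
      refine Nat.cast_le.mp ((SMAStep_cost_le _ h1 h2 h3 (hp β) ?_ f g).trans (Nat.le_ceil _))
      exact le_mul_of_one_le_left (Nat.cast_nonneg _) (one_le_pow₀ one_le_two)

/-- The induction step of the quadratic bound needs this growth estimate; it fails at L = 17, where
the left side is 68882 > 2^16. -/
theorem quadratic_le_two_pow_pred {L : ℕ} (hL : 18 ≤ L) :
    202 * (L + (L + 1) ^ 2) ≤ 2 ^ (L - 1) := by
  obtain ⟨d, rfl⟩ := Nat.exists_eq_add_of_le hL
  rw [show 18 + d - 1 = 17 + d by omega]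
  clear hL
  induction d with
  | zero => norm_num
  | succ d ih =>
    rw [← add_assoc, ← add_assoc, pow_succ 2 (17 + d)]
    nlinarith

theorem SMA_cost_le_of_lt {m : ℕ} (hm : Nat.clog 2 (m + 1) < m) {t : ℝ}
    (ht : ∀ (β : ∀ L, CantorBasis L) (f g : ℕ → ZMod 2),
      ((SMA bitOps β (Nat.clog 2 (m + 1)) f g).cost : ℝ) ≤ 2 ^ Nat.clog 2 (m + 1) * t)
    (β : ∀ L, CantorBasis L) (f g : ℕ → ZMod 2) :
    ((SMA bitOps β m f g).cost : ℝ) ≤ 2 ^ m * (202 * m * (Nat.clog 2 (m + 1) + t)) := by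
  obtain ⟨h1, h2, h3, -⟩ := clog_succ_bounds (m := m) (by omega)
  have h0 : 0 ≤ (2 : ℝ) ^ Nat.clog 2 (m + 1) * t := (Nat.cast_nonneg _).trans (ht β f g)
  rw [SMA_eq_SMAStep _ _ (by omega), if_pos hm]
  exact SMAStep_cost_le _ h1 h2 h3 (p := ⌊(2 : ℝ) ^ Nat.clog 2 (m + 1) * t⌋₊)
    (fun x y => Nat.le_floor (ht β x y)) (Nat.floor_le h0) f g

/-- Passing from m to L ≈ log₂ m gains so much that the factor 202 (L + (L+1)²) is at most 2^(L-1) ≤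
m for large m, and a quadratic bound reproduces itself with the same constant. -/
theorem exists_SMA_cost_le_quadratic : ∃ D : ℝ, 1 ≤ D ∧
    ∀ (m : ℕ) (β : ∀ L, CantorBasis L) (f g : ℕ → ZMod 2),
      ((SMA bitOps β m f g).cost : ℝ) ≤ 2 ^ m * (D * (m + 1) ^ 2) := by
  choose B hB using SMA_cost_bddAbove
  obtain ⟨N, hN⟩ : ∃ N : ℕ, N = 2 ^ 18 := ⟨_, rfl⟩
  -- D dominates the cost for every m < 2^18; from 2^18 on, L ≥ 18 and the induction step applies.
  set D : ℝ := 1 + ∑ m ∈ Finset.range N, (B m : ℝ) with hD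
  have hD1 : 1 ≤ D := le_add_of_nonneg_right (Finset.sum_nonneg fun _ _ => Nat.cast_nonneg _)
  refine ⟨D, hD1, fun m => ?_⟩
  induction m using Nat.strong_induction_on with
  | _ m ih =>
    intro β f g
    by_cases hm : m < N
    · have h1 : (B m : ℝ) ≤ D := by
        have := Finset.single_le_sum (f := fun m => (B m : ℝ)) (fun _ _ => Nat.cast_nonneg _)
          (Finset.mem_range.mpr hm)
        linarith
      have h2 : D * 1 ≤ D * ((m : ℝ) + 1) ^ 2 := by
        gcongr
        exact one_le_pow₀ (by linarith [(Nat.cast_nonneg m : (0 : ℝ) ≤ m)])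
      have h3 : D * ((m : ℝ) + 1) ^ 2 ≤ 2 ^ m * (D * ((m : ℝ) + 1) ^ 2) :=
        le_mul_of_one_le_left (by positivity) (one_le_pow₀ one_le_two)
      have h4 : ((SMA bitOps β m f g).cost : ℝ) ≤ B m := by exact_mod_cast hB m β f g
      linarith
    · obtain ⟨h1, -, h3, h4⟩ := clog_succ_bounds (m := m) (by omega)
      have hL : 18 ≤ Nat.clog 2 (m + 1) := by
        by_contra hc
        have := Nat.pow_le_pow_right two_pos (show Nat.clog 2 (m + 1) ≤ 18 by omega)
        omega
      have hq := (quadratic_le_two_pow_pred hL).trans h4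
      have hlt : Nat.clog 2 (m + 1) < m := by nlinarith
      refine (SMA_cost_le_of_lt hlt (ih _ hlt) β f g).trans ?_
      generalize Nat.clog 2 (m + 1) = L at *
      have hqR : (202 : ℝ) * (L + (L + 1) ^ 2) ≤ m := by exact_mod_cast hq
      have hm0 : (0 : ℝ) ≤ m := Nat.cast_nonneg _
      have hL0 : (L : ℝ) ≤ D * L := le_mul_of_one_le_left (Nat.cast_nonneg _) hD1
      refine mul_le_mul_of_nonneg_left ?_ (by positivity)
      calc 202 * (m : ℝ) * (L + D * (L + 1) ^ 2) ≤ 202 * m * (D * L + D * (L + 1) ^ 2) := by gcongr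
        _ = D * m * (202 * (L + (L + 1) ^ 2)) := by ring
        _ ≤ D * m * m := by gcongr
        _ ≤ D * (m + 1) ^ 2 := by nlinarith

/-- For L = l + 1 one has 2^l ≤ m and 2 ≤ m, so L + 1 = l + 2 ≤ 3 log m / log 2, and 3 / log 2 < 6.
-/
theorem clog_succ_add_one_le_log {m : ℕ} (hm : 2 ≤ m) :
    (Nat.clog 2 (m + 1) : ℝ) + 1 ≤ 6 * Real.log m := by
  obtain ⟨h1, -, -, h4⟩ := clog_succ_bounds (m := m) (by omega)
  obtain ⟨l, hl⟩ := Nat.exists_eq_add_of_le' h1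
  rw [hl] at h4 ⊢
  rw [Nat.add_sub_cancel] at h4
  have hlog2 : Real.log 2 ≤ Real.log m :=
    Real.log_le_log two_pos (by exact_mod_cast hm)
  have hlogl : l * Real.log 2 ≤ Real.log m := by
    rw [← Real.log_pow]
    exact Real.log_le_log (by positivity) (by exact_mod_cast h4)
  have := Real.log_two_gt_d9
  push_cast
  nlinarith [(Nat.cast_nonneg l : (0 : ℝ) ≤ l)]

theorem exists_SMA_cost_le : ∃ C : ℝ, ∀ (β : ∀ L, CantorBasis L) (m : ℕ) (f g : ℕ → ZMod 2),
    2 ≤ m → ((SMA bitOps β m f g).cost : ℝ) ≤ C * (2 ^ m * m * Real.log m ^ 2) := by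
  obtain ⟨D, hD1, hD⟩ := exists_SMA_cost_le_quadratic
  refine ⟨404 * D * 36, fun β m f g hm => ?_⟩
  have key : ((SMA bitOps β m f g).cost : ℝ) ≤
      2 ^ m * (404 * D * m * (Nat.clog 2 (m + 1) + 1) ^ 2) := by
    -- For m = 2 one has L = 2, so there is no recursive call and the quadratic bound is used
    -- directly.
    rcases Nat.lt_or_ge m 3 with h | h
    · obtain rfl : m = 2 := by omega
      have hc : Nat.clog 2 (2 + 1) = 2 := by
        norm_num
      refine (hD 2 β f g).trans ?_
      rw [hc]
      push_cast
      nlinarith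
    · have hlt : Nat.clog 2 (m + 1) < m := by
        have : Nat.clog 2 (m + 1) ≤ m - 1 := by
          refine Nat.clog_le_of_le_pow ?_
          obtain ⟨d, rfl⟩ := Nat.exists_eq_add_of_le h
          have : d < 2 ^ d := Nat.lt_two_pow_self
          rw [show 3 + d - 1 = 2 + d by omega, pow_add]
          omega
        omega
      refine (SMA_cost_le_of_lt hlt (hD _) β f g).trans ?_
      generalize Nat.clog 2 (m + 1) = L
      have hL0 : (0 : ℝ) ≤ L := Nat.cast_nonneg _
      have e : (L : ℝ) ≤ D * (L + 1) ^ 2 := by nlinarith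
      refine mul_le_mul_of_nonneg_left ?_ (by positivity)
      calc 202 * (m : ℝ) * (L + D * (L + 1) ^ 2)
          ≤ 202 * m * (D * (L + 1) ^ 2 + D * (L + 1) ^ 2) := by gcongr
        _ = 404 * D * m * (L + 1) ^ 2 := by ring
  have hlog := clog_succ_add_one_le_log hm
  calc ((SMA bitOps β m f g).cost : ℝ)
      ≤ 2 ^ m * (404 * D * m * (Nat.clog 2 (m + 1) + 1) ^ 2) := key
    _ ≤ 2 ^ m * (404 * D * m * (6 * Real.log m) ^ 2) := by gcongr
    _ = 404 * D * 36 * (2 ^ m * m * Real.log m ^ 2) := by ring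

theorem theorem5p4 :
    (∀ L : ℕ, Nonempty (CantorBasis L)) ∧
    ∃ C : ℝ, ∀ (β : ∀ L : ℕ, CantorBasis L) (m : ℕ) (f g : Polynomial (ZMod 2)),
      f.degree < ((2 ^ m : ℕ) : WithBot ℕ) → g.degree < ((2 ^ m : ℕ) : WithBot ℕ) →
        (SMA bitOps β m f.coeff g.coeff).val = (f * g).coeff ∧
        (2 ≤ m → ((SMA bitOps β m f.coeff g.coeff).cost : ℝ) ≤
          C * ((2 : ℝ) ^ m * (m : ℝ) * Real.log (m : ℝ) ^ 2)) := by
  obtain ⟨C, hC⟩ := exists_SMA_cost_le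
  exact ⟨nonempty_cantorBasis, C, fun β m f g hf hg =>
    ⟨SMA_multipliesBelow β m f g hf hg, hC β m f.coeff g.coeff⟩⟩
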